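/- Let $X,Z,Y$ be binary with $p(Z=1)=p_Z\in(0,1)$ and $p(Y=1\mid X=x,Z=z)=p_{xz}$, where, for real $q_0,q_1\in[0,1]$ and $C,D$, $$p_{00}=q_0-C-Dp_Z,\quad p_{01}=q_0+C+D(1-p_Z),\quad p_{10}=q_1-C+Dp_Z,\quad p_{11}=q_1+C-D(1-p_Z),$$ all assumed to lie in $[0,1]$. From a sample of $N$ units with $n_{xzy}$ units having $(X,Z,Y)=(x,z,y)$, form $R=R_1-R_0$ with $R_x=\frac{\sum_z n_{xz1}}{\sum_{z,y}n_{xzy}}$, and $M=M_1-M_0$ with $M_x=\sum_z \frac{n_{xz1}}{n_{xz0}+n_{xz1}}\cdot\frac{\sum_{x',y}n_{x'zy}}{N}$ (an empty fraction $0/0$ is read as $0$). Let $V$ and $C[\cdot,\cdot]$ denote variance and covariance, and put $$L_R(p)=\frac{p_Z(1-p_Z)}{p(1-p)}\left[2C+(2p-1)D\right]^2,\qquad L_M(p)=\frac{q_1(1-q_1)(1-p)}{Np^2}+\frac{q_0(1-q_0)p}{N(1-p)^2}.$$ (1) Block-randomised $X$: exactly $N^1$ units have $X=1$ and $N^0=N-N^1$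 have $X=0$, and given this all units are sampled independently. Let $\xi=N^1/N$. In the scaling limit $C,D=O(N^{-1/2})$, $$(V[M]-V[R])\cdot N=L_M(\xi)-L_R(\xi)+O(N^{-3/2}),$$ $$(C[R,M]-V[R])\cdot N=-L_R(\xi)+O(N^{-3/2}),$$ $$(C[R,M]-V[M])\cdot N=-L_M(\xi)+O(N^{-3/2}),$$ where the implied constants depend only on $p_Z,q_0,q_1$, on $\varepsilon>0$ with $\varepsilon\le\xi\le1-\varepsilon$, and on $K$ with $|C|,|D|\le KN^{-1/2}$. (2) Random $X$: if instead the $N$ units are independent with $p(X=1)=p_X\in(0,1)$ and $X$ independent of $Z$, the same three expansions hold with $p_X$ in place of $\xi$ (constants depending only on $p_Z,q_0,q_1,p_X,K$). (3) In the setting of (1), suppose that $q_0\in(0,1)$ or $q_1\in(0,1)$, and let $\kappa>0$. Then for all $N$ large enough (depending only on $p_Z,q_0,q_1,\varepsilon,K,\kappa$), whenever $|2C+(2\xi-1)D|\ge\kappa N^{-1/2}$, $$C[R,M]<\min(V[R],V[M])\quad\text{and}\quad V[\alpha^*R+(1-\alpha^*)M]<\min(V[R],V[M]),$$ where $\alpha^*=\dfrac{V[M]-C[R,M]}{(V[R]-C[R,M])+(V[M]-C[R,M])}$.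 -/

import Mathlib

open MeasureTheory ProbabilityTheory

noncomputable section

namespace VStructure

/-- The Bernoulli weight: `p` at `true` (the value 1) and `1 - p` at `false` (the value 0). -/
def bern (p : ℝ) (b : Bool) : ℝ := if b then p else 1 - p

/-- The table `pY x z = p(Y = 1 | X = x, Z = z)` in the parametrisation by `q₀, q₁, C, D`. -/
def tableY (pZ q₀ q₁ C D : ℝ) (x z : Bool) : ℝ :=
  match x, z with
  | false, false => q₀ - C - D * pZ
  | false, true  => q₀ + C + D * (1 - pZ)
  | true,  false => q₁ - C + D * pZ
  | true,  true  => q₁ + C - D * (1 - pZ)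

/-- All the entries of a table are probabilities. -/
def ValidTable (pY : Bool → Bool → ℝ) : Prop := ∀ x z, 0 ≤ pY x z ∧ pY x z ≤ 1

/-- The law of `(Z, Y)` for one unit in the arm `X = x`. -/
def armLaw (pZ : ℝ) (pY : Bool → Bool → ℝ) (x : Bool) : Measure (Bool × Bool) :=
  ∑ v : Bool × Bool, ENNReal.ofReal (bern pZ v.1 * bern (pY x v.1) v.2) • Measure.dirac v

/-- The law of `(X, Z, Y)` for one unit when `X` is random with `p(X = 1) = pX`. -/
def unitLaw (pX pZ : ℝ) (pY : Bool → Bool → ℝ) : Measure (Bool × Bool × Bool) :=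
  ∑ v : Bool × Bool × Bool,
    ENNReal.ofReal (bern pX v.1 * bern pZ v.2.1 * bern (pY v.1 v.2.1) v.2.2) • Measure.dirac v

/-- The sampling law for block-randomised `X`: `n₀` independent units in the arm `X = 0` and,
independently, `n₁` independent units in the arm `X = 1`. -/
def fixedLaw (pZ : ℝ) (pY : Bool → Bool → ℝ) (n₀ n₁ : ℕ) :
    Measure ((Fin n₀ → Bool × Bool) × (Fin n₁ → Bool × Bool)) :=
  (Measure.pi fun _ => armLaw pZ pY false).prod (Measure.pi fun _ => armLaw pZ pY true)

/-- The sampling law for random `X`: `N` independent units. -/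
def randomLaw (pX pZ : ℝ) (pY : Bool → Bool → ℝ) (N : ℕ) : Measure (Fin N → Bool × Bool × Bool) :=
  Measure.pi fun _ => unitLaw pX pZ pY

/-- The number of units with `X = x`, `Z = z`, `Y = y` in a block-randomised sample. -/
def fixedCount {n₀ n₁ : ℕ} (ω : (Fin n₀ → Bool × Bool) × (Fin n₁ → Bool × Bool))
    (x z y : Bool) : ℕ :=
  match x with
  | false => (Finset.univ.filter fun j => ω.1 j = (z, y)).card
  | true  => (Finset.univ.filter fun j => ω.2 j = (z, y)).card

/-- The number of units with `X = x`, `Z = z`, `Y = y` in a sample with random `X`. -/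
def randomCount {N : ℕ} (ω : Fin N → Bool × Bool × Bool) (x z y : Bool) : ℕ :=
  (Finset.univ.filter fun j => ω j = (x, z, y)).card

/-- `R_x`, the fraction of units with `Y = 1` among those with `X = x`.
Here and below an empty fraction `0 / 0` is read as `0`. -/
def armR (n : Bool → Bool → Bool → ℕ) (x : Bool) : ℝ :=
  (∑ z, (n x z true : ℝ)) / ∑ z, ∑ y, (n x z y : ℝ)

/-- The estimator from raw conditionals, `R = R_1 - R_0`. -/
def estR (n : Bool → Bool → Bool → ℕ) : ℝ := armR n true - armR n false

/-- `M_{xz}`: the fraction of units with `Y = 1` among those with `X = x`, `Z = z`, times the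
fraction of all the units that have `Z = z`. -/
def cellM (n : Bool → Bool → Bool → ℕ) (x z : Bool) : ℝ :=
  (n x z true : ℝ) / (∑ y, (n x z y : ℝ)) *
    ((∑ x', ∑ y, (n x' z y : ℝ)) / ∑ x', ∑ z', ∑ y, (n x' z' y : ℝ))

/-- The estimator using marginalisation, `M = M_1 - M_0` with `M_x = M_{x1} + M_{x0}`. -/
def estM (n : Bool → Bool → Bool → ℕ) : ℝ := (∑ z, cellM n true z) - ∑ z, cellM n false z

/-- `V[R]` for block-randomised `X`. -/
def fixedVarR (pZ : ℝ) (pY : Bool → Bool → ℝ) (n₀ n₁ : ℕ) : ℝ :=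
  variance (fun ω => estR (fixedCount ω)) (fixedLaw pZ pY n₀ n₁)

/-- `V[M]` for block-randomised `X`. -/
def fixedVarM (pZ : ℝ) (pY : Bool → Bool → ℝ) (n₀ n₁ : ℕ) : ℝ :=
  variance (fun ω => estM (fixedCount ω)) (fixedLaw pZ pY n₀ n₁)

/-- `C[R, M]` for block-randomised `X`. -/
def fixedCov (pZ : ℝ) (pY : Bool → Bool → ℝ) (n₀ n₁ : ℕ) : ℝ :=
  covariance (fun ω => estR (fixedCount ω)) (fun ω => estM (fixedCount ω)) (fixedLaw pZ pY n₀ n₁)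

/-- `V[α R + (1 - α) M]` for block-randomised `X`. -/
def fixedVarP (pZ : ℝ) (pY : Bool → Bool → ℝ) (n₀ n₁ : ℕ) (α : ℝ) : ℝ :=
  variance (fun ω => α * estR (fixedCount ω) + (1 - α) * estM (fixedCount ω))
    (fixedLaw pZ pY n₀ n₁)

/-- `V[R]` for random `X`. -/
def randomVarR (pX pZ : ℝ) (pY : Bool → Bool → ℝ) (N : ℕ) : ℝ :=
  variance (fun ω => estR (randomCount ω)) (randomLaw pX pZ pY N)

/-- `V[M]` for random `X`. -/
def randomVarM (pX pZ : ℝ) (pY : Bool → Bool → ℝ) (N : ℕ) : ℝ :=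
  variance (fun ω => estM (randomCount ω)) (randomLaw pX pZ pY N)

/-- `C[R, M]` for random `X`. -/
def randomCov (pX pZ : ℝ) (pY : Bool → Bool → ℝ) (N : ℕ) : ℝ :=
  covariance (fun ω => estR (randomCount ω)) (fun ω => estM (randomCount ω)) (randomLaw pX pZ pY N)

/-- The optimal weight `α* = (V[M] - C[R,M]) / ((V[R] - C[R,M]) + (V[M] - C[R,M]))`. -/
def optWeight (vR vM c : ℝ) : ℝ := (vM - c) / ((vR - c) + (vM - c))

/-- The leading term of `(V[R] - C[R,M]) N`; the argument `p` stands for `ξ` or `p_X`. -/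
def leadR (pZ C D p : ℝ) : ℝ := pZ * (1 - pZ) / (p * (1 - p)) * (2 * C + (2 * p - 1) * D) ^ 2

/-- The leading term of `(V[M] - C[R,M]) N`; the argument `p` stands for `ξ` or `p_X`. -/
def leadM (q₀ q₁ N p : ℝ) : ℝ :=
  q₁ * (1 - q₁) * (1 - p) / (N * p ^ 2) + q₀ * (1 - q₀) * p / (N * (1 - p) ^ 2)

/-- The three expansions at `p`, with all error terms at most `B N^{-3/2}`, for the
variances `vR`, `vM` and the covariance `c`. -/
def Expansions (B pZ q₀ q₁ C D p : ℝ) (N : ℕ) (vR vM c : ℝ) : Prop :=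
  |(vM - vR) * N - (leadM q₀ q₁ N p - leadR pZ C D p)| ≤ B * (N : ℝ) ^ (-(3 / 2) : ℝ) ∧
  |(c - vR) * N - (-leadR pZ C D p)| ≤ B * (N : ℝ) ^ (-(3 / 2) : ℝ) ∧
  |(c - vM) * N - (-leadM q₀ q₁ N p)| ≤ B * (N : ℝ) ^ (-(3 / 2) : ℝ)

end VStructure

end

set_option linter.unusedSectionVars false

/-! By bilinearity `C[R,M] - V[R] = C[R, M - R]` and `V[M] - C[R,M] = C[M, M - R]`, so only these
two covariances have to be expanded; large common parts of the variances never appear. Given `X` and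
`Z`, both estimators are linear in the independent Bernoulli variables `Y` (`estR_tripleCount`,
`estM_tripleCount`), so their conditional means and covariances are explicit. The law of total
covariance (`armCov_eq`) then reduces everything to moments of `u₁, u₀` (`armDev`), the deviations
from `p_Z` of the fraction of `Z = 1` in each arm, and of their size-weighted mean `t` (`totalDev`).

If no cell is empty, the conditional means of `R` and `M`, centred at `q₁ - q₀`, are `U = (2C - D)u₁
- (2C + D)u₀` and `P = -2Dt`. Here `P - U = -(2C + (2ξ - 1)D)(u₁ - u₀)`, and the pooled mean `t` is
uncorrelated with `u₁ - u₀`. Hence `E[P(P - U)] = 0` and `E[U(P - U)] = -E[(P - U)²]`, which is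
exactly `-L_R / N` (`wE_meanDevR_mul`, `wE_meanDevM_mul`).

The conditional covariance of `R` with `M - R` is linear in the deviations, so it averages to zero.
That of `M` with `M - R` has the additional quadratic term `∑ₐ (t - uₐ)² (vₐ₁/(p + uₐ) + vₐ₀/(1 - p
- uₐ)) / nₐ`, where `vₐ_b` are the variances of `Y` in the cells. Replacing `vₐ_b` by `qₐ(1 - qₐ)`
and `p + uₐ` by `p` yields a term of mean exactly `L_M / N` (`wE_mainTerm`). The replacement costs a
further factor of order `N^{-1/2}`, hence `N^{-5/2}` in all (`wE_quadError_le`). When some `uₐ` is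
large, cells may be empty and the formulas fail; there the estimators are merely bounded, and a
sixth moment makes the contribution `O(N^{-3})` (`wE_badness_le`). Multiplying by `N` gives the
errors `N^{-3/2}`.

For random `X`, one conditions on `X` as well. The conditional means of `R` and `M` given `X` are
almost constant, so their covariance is negligible, and the leading terms are Lipschitz in the
fraction of treated units with constant `O(1/N)`, while that fraction deviates from `p_X` by order
`N^{-1/2}` (`abs_wE_sub_le_of_sizeDev`).

For the last claim, both leading terms are bounded below by a multiple of `1/N` and dominate the
error. The variance at the optimal weight is `c + ab/(a + b)` with `a = V[R] - c` and `b = V[M] -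
c`, below both variances when `a, b > 0` (`combination_lt_min`). -/

/-- The expectation of `f` under the weights `w` on a finite type. -/
def wE {Ω : Type*} [Fintype Ω] (w f : Ω → ℝ) : ℝ := ∑ b, w b * f b

/-- Nonnegative weights of total mass one. -/
structure IsWeight {Ω : Type*} [Fintype Ω] (w : Ω → ℝ) : Prop where
  nonneg : ∀ b, 0 ≤ w b
  sum_eq : ∑ b, w b = 1

/-! ### Expectation and covariance under finite weights -/

section Weighted

variable {Ω : Type*} [Fintype Ω] {w : Ω → ℝ}

theorem wE_add (f g : Ω → ℝ) : wE w (fun b => f b + g b) = wE w f + wE w g := by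
  simp [wE, mul_add, Finset.sum_add_distrib]

theorem wE_sub (f g : Ω → ℝ) : wE w (fun b => f b - g b) = wE w f - wE w g := by
  simp [wE, mul_sub, Finset.sum_sub_distrib]

theorem wE_mul_left (c : ℝ) (f : Ω → ℝ) : wE w (fun b => c * f b) = c * wE w f := by
  simp only [wE, Finset.mul_sum]
  exact Finset.sum_congr rfl fun _ _ => by ring

theorem wE_sum {κ : Type*} (s : Finset κ) (f : κ → Ω → ℝ) :
    wE w (fun b => ∑ k ∈ s, f k b) = ∑ k ∈ s, wE w (f k) := by
  simp only [wE, Finset.mul_sum]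
  exact Finset.sum_comm

theorem wE_const (hw : IsWeight w) (c : ℝ) : wE w (fun _ => c) = c := by
  simp [wE, ← Finset.sum_mul, hw.sum_eq]

theorem wE_mono (hw : IsWeight w) {f g : Ω → ℝ} (h : ∀ b, f b ≤ g b) : wE w f ≤ wE w g :=
  Finset.sum_le_sum fun b _ => mul_le_mul_of_nonneg_left (h b) (hw.nonneg b)

theorem wE_nonneg (hw : IsWeight w) {f : Ω → ℝ} (h : ∀ b, 0 ≤ f b) : 0 ≤ wE w f :=
  Finset.sum_nonneg fun b _ => mul_nonneg (hw.nonneg b) (h b)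

theorem abs_wE_le (hw : IsWeight w) {f g : Ω → ℝ} (h : ∀ b, |f b| ≤ g b) : |wE w f| ≤ wE w g := by
  refine (Finset.abs_sum_le_sum_abs _ _).trans (Finset.sum_le_sum fun b _ => ?_)
  rw [abs_mul, abs_of_nonneg (hw.nonneg b)]
  exact mul_le_mul_of_nonneg_left (h b) (hw.nonneg b)

theorem abs_wE_le_const (hw : IsWeight w) {f : Ω → ℝ} {c : ℝ} (h : ∀ b, |f b| ≤ c) :
    |wE w f| ≤ c := (abs_wE_le hw h).trans_eq (wE_const hw c)

/-- The covariance of `f` and `g` under the weights `w`. -/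
def wCov (w f g : Ω → ℝ) : ℝ := wE w (fun b => f b * g b) - wE w f * wE w g

theorem wCov_sub_const (hw : IsWeight w) (f g : Ω → ℝ) (c d : ℝ) :
    wCov w (fun b => f b - c) (fun b => g b - d) = wCov w f g := by
  have h : (fun b => (f b - c) * (g b - d)) = fun b => ((f b * g b - d * f b) - c * g b) + c * d := by
    funext b; ring
  simp only [wCov, h, wE_sub, wE_add, wE_mul_left, wE_const hw]
  ring

theorem wCov_sub_right (f g h : Ω → ℝ) :
    wCov w f (fun b => g b - h b) = wCov w f g - wCov w f h := by
  simp only [wCov, mul_sub, wE_sub]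
  ring

theorem wCov_comm (f g : Ω → ℝ) : wCov w f g = wCov w g f := by
  simp only [wCov, mul_comm]

theorem abs_wCov_le (hw : IsWeight w) {f g : Ω → ℝ} {c d : ℝ} (hf : ∀ b, |f b| ≤ c)
    (hg : ∀ b, |g b| ≤ d) (hc : 0 ≤ c) : |wCov w f g| ≤ 2 * (c * d) := by
  have h1 : |wE w (fun b => f b * g b)| ≤ c * d := abs_wE_le_const hw fun b => by
    rw [abs_mul]; exact mul_le_mul (hf b) (hg b) (abs_nonneg _) hc
  have h2 : |wE w f * wE w g| ≤ c * d := by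
    rw [abs_mul]
    exact mul_le_mul (abs_wE_le_const hw hf) (abs_wE_le_const hw hg) (abs_nonneg _) hc
  have := abs_sub (wE w (fun b => f b * g b)) (wE w f * wE w g)
  unfold wCov
  linarith

end Weighted

/-- The numerical value of a Boolean. -/
def bval (b : Bool) : ℝ := if b then 1 else 0

@[simp] theorem bval_true : bval true = 1 := rfl
@[simp] theorem bval_false : bval false = 0 := rfl

/-! ### Moments of independent Bernoulli variables -/

section Bernoulli

variable {ι : Type*} [Fintype ι] [DecidableEq ι]

/-- The weights of independent Bernoulli variables with parameters `p`. -/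
def bernWeight (p : ι → ℝ) (b : ι → Bool) : ℝ := ∏ i, VStructure.bern (p i) (b i)

/-- Independence, obtained by expanding a product of two-term sums over all choices. All the
Bernoulli moments below come from suitable factors `g`. -/
theorem wE_bern_prod (p : ι → ℝ) (g : ι → Bool → ℝ) :
    wE (bernWeight p) (fun b => ∏ i, g i (b i)) =
      ∏ i, (p i * g i true + (1 - p i) * g i false) := by
  have h := Finset.prod_univ_sum (fun _ : ι => (Finset.univ : Finset Bool))
    (fun i b => VStructure.bern (p i) b * g i b)
  simp only [Fintype.piFinset_univ, Fintype.sum_bool] at h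
  simp only [wE, bernWeight, ← Finset.prod_mul_distrib]
  rw [← h]
  simp [VStructure.bern]

theorem isWeight_bern {p : ι → ℝ} (h0 : ∀ i, 0 ≤ p i) (h1 : ∀ i, p i ≤ 1) :
    IsWeight (bernWeight p) where
  nonneg b := Finset.prod_nonneg fun i _ => by
    unfold VStructure.bern; split_ifs
    · exact h0 i
    · linarith [h1 i]
  sum_eq := by
    have := wE_bern_prod p (fun _ _ => 1)
    simpa [wE] using this

theorem wE_bern_centered (p : ι → ℝ) (i : ι) :
    wE (bernWeight p) (fun b => bval (b i) - p i) = 0 := by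
  -- The factor at `i` is the centred variable and all other factors are 1, so the product contains
  -- a zero factor.
  have h := wE_bern_prod p (fun k b => if k = i then bval b - p i else 1)
  simp only [Finset.prod_ite_eq', Finset.mem_univ, if_true] at h
  rw [h]
  apply Finset.prod_eq_zero (Finset.mem_univ i)
  simp; ring

theorem wE_bern_centered_mul (p : ι → ℝ) (i j : ι) :
    wE (bernWeight p) (fun b => (bval (b i) - p i) * (bval (b j) - p j)) =
      if i = j then p i * (1 - p i) else 0 := by
  have h := wE_bern_prod p (fun k b =>
    (if k = i then bval b - p i else 1) * (if k = j then bval b - p j else 1))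
  simp only [Finset.prod_mul_distrib, Finset.prod_ite_eq', Finset.mem_univ, if_true] at h
  rw [h]
  split_ifs with hij
  · subst hij
    rw [Finset.prod_eq_single i]
    · simp; ring
    · intro k _ hk; simp [hk]
    · simp
  · apply Finset.prod_eq_zero (Finset.mem_univ i)
    simp [hij]; ring

theorem wE_bern_linear (p c : ι → ℝ) :
    wE (bernWeight p) (fun b => ∑ i, c i * (bval (b i) - p i)) = 0 := by
  simp [wE_sum, wE_mul_left, wE_bern_centered]

theorem wE_bern_linear_mul (p c d : ι → ℝ) :
    wE (bernWeight p) (fun b => (∑ i, c i * (bval (b i) - p i)) * ∑ i, d i * (bval (b i) - p i)) =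
      ∑ i, c i * d i * (p i * (1 - p i)) := by
  have h : (fun b : ι → Bool => (∑ i, c i * (bval (b i) - p i)) * ∑ i, d i * (bval (b i) - p i)) =
      fun b => ∑ i, ∑ j, (c i * d j) * ((bval (b i) - p i) * (bval (b j) - p j)) := by
    funext b
    rw [Finset.sum_mul_sum]
    exact Finset.sum_congr rfl fun _ _ => Finset.sum_congr rfl fun _ _ => by ring
  simp [h, wE_sum, wE_mul_left, wE_bern_centered_mul]

theorem wE_bern_val {p : ι → ℝ} (hw : IsWeight (bernWeight p)) (c : ι → ℝ) :
    wE (bernWeight p) (fun b => ∑ i, c i * bval (b i)) = ∑ i, c i * p i := by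
  have h := wE_bern_linear p c
  simp only [mul_sub, Finset.sum_sub_distrib, wE_sub, wE_const hw] at h
  linarith

theorem wCov_bern_val {p : ι → ℝ} (hw : IsWeight (bernWeight p)) (c d : ι → ℝ) :
    wCov (bernWeight p) (fun b => ∑ i, c i * bval (b i)) (fun b => ∑ i, d i * bval (b i)) =
      ∑ i, c i * d i * (p i * (1 - p i)) := by
  have h := wCov_sub_const hw (fun b => ∑ i, c i * bval (b i)) (fun b => ∑ i, d i * bval (b i))
    (∑ i, c i * p i) (∑ i, d i * p i)
  simp only [← Finset.sum_sub_distrib, ← mul_sub] at h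
  rw [← h, wCov, wE_bern_linear_mul, wE_bern_linear]
  ring

/-- The exponential moment factorises, and `exp u ≤ 1 + u + u²` for `|u| ≤ 1` controls each factor:
the linear terms cancel by centring, leaving `1 + p(1 - p)c² ≤ exp (c²)`. -/
theorem wE_bern_exp_le {p : ι → ℝ} (h0 : ∀ i, 0 ≤ p i) (h1 : ∀ i, p i ≤ 1) {c : ι → ℝ}
    (hc : ∀ i, |c i| ≤ 1) :
    wE (bernWeight p) (fun b => Real.exp (∑ i, c i * (bval (b i) - p i))) ≤
      Real.exp (∑ i, c i ^ 2) := by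
  simp only [Real.exp_sum]
  rw [wE_bern_prod p (fun i b => Real.exp (c i * (bval b - p i)))]
  refine Finset.prod_le_prod (fun i _ => ?_) (fun i _ => ?_)
  · have := h0 i; have := h1 i
    have : 0 ≤ 1 - p i := by linarith
    positivity
  have key : ∀ u : ℝ, |u| ≤ 1 → Real.exp u ≤ 1 + u + u ^ 2 := fun u hu => by
    have := (abs_le.1 (Real.abs_exp_sub_one_sub_id_le hu)).2
    linarith
  have e1 : Real.exp (c i * (bval true - p i)) ≤ 1 + c i * (1 - p i) + (c i * (1 - p i)) ^ 2 := by
    refine key _ ?_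
    rw [abs_mul]
    refine mul_le_one₀ (hc i) (abs_nonneg _) ?_
    rw [abs_le]; constructor <;> simp <;> linarith [h0 i, h1 i]
  have e2 : Real.exp (c i * (bval false - p i)) ≤ 1 + c i * (0 - p i) + (c i * (0 - p i)) ^ 2 := by
    refine key _ ?_
    rw [abs_mul]
    refine mul_le_one₀ (hc i) (abs_nonneg _) ?_
    rw [abs_le]; constructor <;> simp <;> linarith [h0 i, h1 i]
  have hp := h0 i
  have hp' : 0 ≤ 1 - p i := by linarith [h1 i]
  have e3 := mul_le_mul_of_nonneg_left e1 hp
  have e4 := mul_le_mul_of_nonneg_left e2 hp'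
  have e5 := Real.add_one_le_exp (c i ^ 2)
  have e6 : p i * (1 - p i) * c i ^ 2 ≤ 1 * c i ^ 2 :=
    mul_le_mul_of_nonneg_right (by nlinarith) (sq_nonneg _)
  nlinarith

theorem pow_even_le_exp (k : ℕ) (u : ℝ) :
    u ^ (2 * k) ≤ ((2 * k).factorial : ℝ) * (Real.exp u + Real.exp (-u)) := by
  have h := Real.pow_div_factorial_le_exp |u| (abs_nonneg u) (2 * k)
  rw [div_le_iff₀ (by positivity), pow_mul, sq_abs, ← pow_mul] at h
  have h2 : Real.exp |u| ≤ Real.exp u + Real.exp (-u) := by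
    rcases abs_cases u with ⟨e, _⟩ | ⟨e, _⟩ <;> rw [e] <;> linarith [Real.exp_pos u, Real.exp_pos (-u)]
  calc u ^ (2 * k) ≤ Real.exp |u| * ((2 * k).factorial : ℝ) := h
    _ ≤ _ := by rw [mul_comm]; gcongr

/-- The constant of the moment bound of order `2 k`. -/
noncomputable def momentConst (k : ℕ) : ℝ := ((2 * k).factorial : ℝ) * (2 * Real.exp 1)

theorem momentConst_pos (k : ℕ) : 0 < momentConst k := by unfold momentConst; positivity

/-- The sum is multiplied by `±√n`: the coefficients become at most 1 in modulus and their squares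
sum to at most 1, so both exponential moments are at most `e`. An even power is dominated by the two
exponentials. -/
theorem wE_bern_moment_le {p : ι → ℝ} (h0 : ∀ i, 0 ≤ p i) (h1 : ∀ i, p i ≤ 1) {c : ι → ℝ} {n : ℝ}
    (hn : 0 < n) (hc : ∀ i, |c i| ≤ 1 / √n) (hs : ∑ i, c i ^ 2 ≤ 1 / n) (k : ℕ) :
    wE (bernWeight p) (fun b => (∑ i, c i * (bval (b i) - p i)) ^ (2 * k)) ≤
      momentConst k / n ^ k := by
  have hr : 0 < √n := Real.sqrt_pos.2 hn
  have hr2 : √n ^ 2 = n := Real.sq_sqrt hn.le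
  have hw := isWeight_bern h0 h1
  have aux : ∀ s : ℝ, s ^ 2 = n → |s| = √n →
      wE (bernWeight p) (fun b => Real.exp (s * ∑ i, c i * (bval (b i) - p i))) ≤ Real.exp 1 := by
    intro s hs2 hsa
    have := wE_bern_exp_le h0 h1 (c := fun i => s * c i) (fun i => by
      rw [abs_mul, hsa]
      calc √n * |c i| ≤ √n * (1 / √n) := by gcongr; exact hc i
        _ = 1 := by field_simp)
    simp only [mul_assoc, ← Finset.mul_sum] at this
    refine this.trans (Real.exp_le_exp.2 ?_)
    simp only [mul_pow, ← Finset.mul_sum, hs2]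
    calc n * ∑ i, c i ^ 2 ≤ n * (1 / n) := by gcongr
      _ = 1 := by field_simp
  have a1 := aux (√n) hr2 (abs_of_pos hr)
  have a2 := aux (-√n) (by rw [neg_sq, hr2]) (by rw [abs_neg, abs_of_pos hr])
  rw [le_div_iff₀ (by positivity), mul_comm, ← wE_mul_left]
  calc wE (bernWeight p) (fun b => n ^ k * (∑ i, c i * (bval (b i) - p i)) ^ (2 * k))
      ≤ wE (bernWeight p) (fun b => ((2 * k).factorial : ℝ) *
          (Real.exp (√n * ∑ i, c i * (bval (b i) - p i)) +
           Real.exp (-√n * ∑ i, c i * (bval (b i) - p i)))) := by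
        refine wE_mono hw fun b => ?_
        have := pow_even_le_exp k (√n * ∑ i, c i * (bval (b i) - p i))
        rwa [mul_pow, pow_mul √n, hr2, ← neg_mul] at this
    _ ≤ momentConst k := by
        rw [wE_mul_left, wE_add, momentConst]
        gcongr
        linarith

end Bernoulli

/-! ### Crude bounds on the estimators -/

section Bounds

variable (n : Bool → Bool → Bool → ℕ)

theorem armR_mem (a : Bool) : 0 ≤ VStructure.armR n a ∧ VStructure.armR n a ≤ 1 := by
  refine ⟨by unfold VStructure.armR; positivity, div_le_one_of_le₀ ?_ (by positivity)⟩
  simp only [Fintype.sum_bool]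
  have h1 : (0 : ℝ) ≤ n a true false := Nat.cast_nonneg _
  have h2 : (0 : ℝ) ≤ n a false false := Nat.cast_nonneg _
  linarith

theorem abs_estR_le : |VStructure.estR n| ≤ 1 := by
  have h1 := armR_mem n true
  have h0 := armR_mem n false
  rw [VStructure.estR, abs_le]
  constructor <;> linarith [h1.1, h1.2, h0.1, h0.2]

theorem cellM_nonneg (a b : Bool) : 0 ≤ VStructure.cellM n a b := by
  unfold VStructure.cellM; positivity

/-- The conditional fraction is at most 1, also when it is `0 / 0 = 0`. The remaining factors add up
to at most 1 over the two values of `Z`, so `M` stays bounded on every sample. -/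
theorem cellM_le (a b : Bool) : VStructure.cellM n a b ≤
    (∑ x', ∑ y, (n x' b y : ℝ)) / ∑ x', ∑ z', ∑ y, (n x' z' y : ℝ) := by
  unfold VStructure.cellM
  refine mul_le_of_le_one_left (by positivity) (div_le_one_of_le₀ ?_ (by positivity))
  simp only [Fintype.sum_bool]
  have h1 : (0 : ℝ) ≤ n a b false := Nat.cast_nonneg _
  linarith

theorem sum_cellM_mem (a : Bool) :
    0 ≤ ∑ z, VStructure.cellM n a z ∧ ∑ z, VStructure.cellM n a z ≤ 1 := by
  refine ⟨Finset.sum_nonneg fun z _ => cellM_nonneg n a z, ?_⟩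
  refine (Finset.sum_le_sum fun z _ => cellM_le n a z).trans ?_
  rw [← Finset.sum_div]
  refine div_le_one_of_le₀ (le_of_eq ?_) (by positivity)
  simp only [Fintype.sum_bool]; ring

theorem abs_estM_le : |VStructure.estM n| ≤ 1 := by
  have h1 := sum_cellM_mem n true
  have h0 := sum_cellM_mem n false
  rw [VStructure.estM, abs_le]
  constructor <;> linarith [h1.1, h1.2, h0.1, h0.2]

end Bounds

/-! ### The estimators as linear forms in the outcomes -/

section Counts

variable {ι : Type*} [Fintype ι]

/-- The number of units with values `a`, `b`, `c`. -/
def tripleCount (x z y : ι → Bool) (a b c : Bool) : ℕ :=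
  (Finset.univ.filter fun i => x i = a ∧ z i = b ∧ y i = c).card

/-- The number of units in the arm `a`, as a real number. -/
def armSize (x : ι → Bool) (a : Bool) : ℝ := ∑ i, if x i = a then 1 else 0

/-- The number of units with `X = a` and `Z = b`, as a real number. -/
def cellSize (x z : ι → Bool) (a b : Bool) : ℝ := ∑ i, if x i = a ∧ z i = b then 1 else 0

/-- Sorting units by their values turns sums over units into sums over cells. -/
theorem sum_eq_sum_tripleCount (x z y : ι → Bool) (f : Bool → Bool → Bool → ℝ) :
    ∑ i, f (x i) (z i) (y i) = ∑ a, ∑ b, ∑ c, (tripleCount x z y a b c : ℝ) * f a b c := by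
  have h : ∀ a b c, (tripleCount x z y a b c : ℝ) * f a b c =
      ∑ i, if x i = a ∧ z i = b ∧ y i = c then f a b c else 0 := by
    intro a b c
    rw [tripleCount, Finset.card_filter, Nat.cast_sum, Finset.sum_mul]
    refine Finset.sum_congr rfl fun i _ => ?_
    split_ifs <;> simp
  simp only [h, Fintype.sum_bool, ← Finset.sum_add_distrib]
  refine Finset.sum_congr rfl fun i _ => ?_
  cases x i <;> cases z i <;> cases y i <;> simp

theorem sum_eq_sum_cellSize (x z : ι → Bool) (f : Bool → Bool → ℝ) :
    ∑ i, f (x i) (z i) = ∑ a, ∑ b, cellSize x z a b * f a b := by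
  simp only [cellSize, Finset.sum_mul, Fintype.sum_bool, ← Finset.sum_add_distrib]
  refine Finset.sum_congr rfl fun i _ => ?_
  cases x i <;> cases z i <;> simp

theorem sum_tripleCount_eq_cellSize (x z y : ι → Bool) (a b : Bool) :
    ∑ c, (tripleCount x z y a b c : ℝ) = cellSize x z a b := by
  have := sum_eq_sum_tripleCount x z y (fun a' b' _ => if a' = a ∧ b' = b then 1 else 0)
  rw [cellSize, this]
  cases a <;> cases b <;> simp

theorem sum_cellSize_eq_armSize (x z : ι → Bool) (a : Bool) :
    ∑ b, cellSize x z a b = armSize x a := by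
  have := sum_eq_sum_cellSize x z (fun a' _ => if a' = a then 1 else 0)
  rw [armSize, this]
  cases a <;> simp

theorem sum_armSize (x : ι → Bool) : ∑ a, armSize x a = Fintype.card ι := by
  simp only [armSize, Fintype.sum_bool, ← Finset.sum_add_distrib]
  rw [Fintype.card_eq_sum_ones, Nat.cast_sum]
  refine Finset.sum_congr rfl fun i _ => ?_
  cases x i <;> simp

theorem cellSize_nonneg (x z : ι → Bool) (a b : Bool) : 0 ≤ cellSize x z a b :=
  Finset.sum_nonneg fun i _ => by split_ifs <;> norm_num

theorem armSize_nonneg (x : ι → Bool) (a : Bool) : 0 ≤ armSize x a :=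
  Finset.sum_nonneg fun i _ => by split_ifs <;> norm_num

/-- The sign with which an arm enters a difference of arms. -/
def armSign (a : Bool) : ℝ := if a then 1 else -1

@[simp] theorem armSign_true : armSign true = 1 := rfl
@[simp] theorem armSign_false : armSign false = -1 := rfl

/-- The coefficient of `y i` in the estimator `R`. -/
noncomputable def coefR (x : ι → Bool) (i : ι) : ℝ := armSign (x i) / armSize x (x i)

/-- The coefficient of `y i` in the estimator `M`. -/
noncomputable def coefM (x z : ι → Bool) (i : ι) : ℝ :=
  armSign (x i) * ((∑ a, cellSize x z a (z i)) / ∑ a, armSize x a) / cellSize x z (x i) (z i)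

theorem estR_tripleCount (x z y : ι → Bool) :
    VStructure.estR (tripleCount x z y) = ∑ i, coefR x i * bval (y i) := by
  have h := sum_eq_sum_tripleCount x z y (fun a _ c => armSign a / armSize x a * bval c)
  have e : ∑ i, coefR x i * bval (y i) = ∑ i, armSign (x i) / armSize x (x i) * bval (y i) := rfl
  rw [e, h, VStructure.estR, VStructure.armR, VStructure.armR]
  simp only [sum_tripleCount_eq_cellSize, sum_cellSize_eq_armSize]
  simp only [Fintype.sum_bool]
  simp; ring

/-- This needs no condition on the cells: a vanishing denominator has inverse zero on both sides. -/
theorem estM_tripleCount (x z y : ι → Bool) :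
    VStructure.estM (tripleCount x z y) = ∑ i, coefM x z i * bval (y i) := by
  have h := sum_eq_sum_tripleCount x z y (fun a b c =>
    armSign a * ((∑ a', cellSize x z a' b) / ∑ a', armSize x a') / cellSize x z a b * bval c)
  have e : ∑ i, coefM x z i * bval (y i) = ∑ i, armSign (x i) *
    ((∑ a', cellSize x z a' (z i)) / ∑ a', armSize x a') / cellSize x z (x i) (z i) *
      bval (y i) := rfl
  rw [e, h, VStructure.estM]
  simp only [VStructure.cellM, sum_tripleCount_eq_cellSize, sum_cellSize_eq_armSize]
  simp only [Fintype.sum_bool]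
  simp; ring

/-- The deviation of the fraction of units with `Z = 1` in the arm `a` from `p`. -/
noncomputable def armDev (x : ι → Bool) (p : ℝ) (z : ι → Bool) (a : Bool) : ℝ :=
  ∑ i, (if x i = a then 1 / armSize x a else 0) * (bval (z i) - p)

/-- The deviation of the fraction of units with `Z = 1` from `p`. -/
noncomputable def totalDev (x : ι → Bool) (p : ℝ) (z : ι → Bool) : ℝ :=
  (∑ a, armSize x a * armDev x p z a) / ∑ a, armSize x a

theorem cellSize_true {x : ι → Bool} {a : Bool} (h : 0 < armSize x a) (p : ℝ) (z : ι → Bool) :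
    cellSize x z a true = armSize x a * (p + armDev x p z a) := by
  have h1 : armDev x p z a = (1 / armSize x a) * (cellSize x z a true - p * armSize x a) := by
    have := sum_eq_sum_cellSize x z
      (fun a' b => (if a' = a then 1 / armSize x a else 0) * (bval b - p))
    rw [armDev, this, ← sum_cellSize_eq_armSize x z a]
    cases a <;> simp <;> ring
  rw [h1]; field_simp; ring

theorem cellSize_false {x : ι → Bool} {a : Bool} (h : 0 < armSize x a) (p : ℝ) (z : ι → Bool) :
    cellSize x z a false = armSize x a * (1 - p - armDev x p z a) := by
  have h1 := sum_cellSize_eq_armSize x z a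
  rw [Fintype.sum_bool, cellSize_true h p z] at h1
  linarith

/-- Both cell sizes in the arm are nonnegative, so `p + u` and `1 - p - u` are. -/
theorem abs_armDev_le {x : ι → Bool} {a : Bool} (h : 0 < armSize x a) {p : ℝ} (hp0 : 0 ≤ p)
    (hp1 : p ≤ 1) (z : ι → Bool) : |armDev x p z a| ≤ 1 := by
  have h1 := cellSize_nonneg x z a true
  have h2 := cellSize_nonneg x z a false
  rw [cellSize_true h p] at h1
  rw [cellSize_false h p] at h2
  have h3 := nonneg_of_mul_nonneg_right h1 h
  have h4 := nonneg_of_mul_nonneg_right h2 h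
  rw [abs_le]; constructor <;> linarith

theorem sum_coefR_mul {x : ι → Bool} (hx : ∀ a, 0 < armSize x a) (p : ℝ) (z : ι → Bool)
    (g : Bool → Bool → ℝ) :
    ∑ i, coefR x i * g (x i) (z i) = ∑ a, armSign a *
      ((p + armDev x p z a) * g a true + (1 - p - armDev x p z a) * g a false) := by
  have h := sum_eq_sum_cellSize x z (fun a b => armSign a / armSize x a * g a b)
  simp only [coefR]
  rw [h]
  refine Finset.sum_congr rfl fun a _ => ?_
  have := (hx a).ne'
  rw [Fintype.sum_bool, cellSize_true (hx a) p, cellSize_false (hx a) p]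
  field_simp

theorem frac_true {x : ι → Bool} (hx : ∀ a, 0 < armSize x a) (p : ℝ) (z : ι → Bool) :
    (∑ a, cellSize x z a true) / ∑ a, armSize x a = p + totalDev x p z := by
  have h0 := hx false
  have h1 := hx true
  simp only [totalDev, Fintype.sum_bool, cellSize_true (hx _) p]
  field_simp; ring

theorem frac_false {x : ι → Bool} (hx : ∀ a, 0 < armSize x a) (p : ℝ) (z : ι → Bool) :
    (∑ a, cellSize x z a false) / ∑ a, armSize x a = 1 - p - totalDev x p z := by
  have h0 := hx false
  have h1 := hx true
  simp only [totalDev, Fintype.sum_bool, cellSize_false (hx _) p]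
  field_simp; ring

/-- The size of each cell cancels against the denominator of its coefficient, leaving the overall
fraction of that value of `Z`. An empty cell would lose its share, whence the positivity hypotheses.
-/
theorem sum_coefM_mul {x : ι → Bool} (hx : ∀ a, 0 < armSize x a) {p : ℝ} {z : ι → Bool}
    (h1 : ∀ a, 0 < p + armDev x p z a) (h0 : ∀ a, 0 < 1 - p - armDev x p z a)
    (g : Bool → Bool → ℝ) :
    ∑ i, coefM x z i * g (x i) (z i) = ∑ a, armSign a *
      ((p + totalDev x p z) * g a true + (1 - p - totalDev x p z) * g a false) := by
  have h := sum_eq_sum_cellSize x z (fun a b => armSign a *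
    ((∑ a', cellSize x z a' b) / ∑ a', armSize x a') / cellSize x z a b * g a b)
  simp only [coefM]
  rw [h]
  refine Finset.sum_congr rfl fun a _ => ?_
  rw [Fintype.sum_bool, frac_true hx p, frac_false hx p, cellSize_true (hx a) p,
    cellSize_false (hx a) p]
  have := (hx a).ne'
  have := (h1 a).ne'
  have := (h0 a).ne'
  field_simp

/-- On a cell with `Z = 1` the coefficients differ by `±(t - u) / (nₐ(p + u))`. The factor `p + u`
cancels against the cell size, so the result is linear in the deviations; the case `Z = 0` is the
same with the opposite sign. -/
theorem sum_coefR_mul_sub {x : ι → Bool} (hx : ∀ a, 0 < armSize x a) {p : ℝ} {z : ι → Bool}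
    (h1 : ∀ a, 0 < p + armDev x p z a) (h0 : ∀ a, 0 < 1 - p - armDev x p z a)
    (g : Bool → Bool → ℝ) :
    ∑ i, coefR x i * (coefM x z i - coefR x i) * g (x i) (z i) = ∑ a, 1 / armSize x a *
      ((g a true - g a false) * (totalDev x p z - armDev x p z a)) := by
  have h := sum_eq_sum_cellSize x z (fun a b => armSign a / armSize x a * (armSign a *
    ((∑ a', cellSize x z a' b) / ∑ a', armSize x a') / cellSize x z a b -
      armSign a / armSize x a) * g a b)
  simp only [coefM, coefR]
  rw [h]
  refine Finset.sum_congr rfl fun a _ => ?_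
  rw [Fintype.sum_bool, frac_true hx p, frac_false hx p, cellSize_true (hx a) p,
    cellSize_false (hx a) p]
  have := (hx a).ne'
  have := (h1 a).ne'
  have := (h0 a).ne'
  have hs : armSign a ^ 2 = 1 := by cases a <;> simp
  field_simp
  rw [hs]; ring

/-- Writing the first coefficient as that of `R` plus the difference, the `R` part gives the linear
term of `sum_coefR_mul_sub`, and the square of the difference gives the quadratic one. -/
theorem sum_coefM_mul_sub {x : ι → Bool} (hx : ∀ a, 0 < armSize x a) {p : ℝ} {z : ι → Bool}
    (h1 : ∀ a, 0 < p + armDev x p z a) (h0 : ∀ a, 0 < 1 - p - armDev x p z a)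
    (g : Bool → Bool → ℝ) :
    ∑ i, coefM x z i * (coefM x z i - coefR x i) * g (x i) (z i) = ∑ a, 1 / armSize x a *
      ((g a true - g a false) * (totalDev x p z - armDev x p z a) +
        (totalDev x p z - armDev x p z a) ^ 2 *
          (g a true / (p + armDev x p z a) + g a false / (1 - p - armDev x p z a))) := by
  have h := sum_eq_sum_cellSize x z (fun a b => (armSign a *
    ((∑ a', cellSize x z a' b) / ∑ a', armSize x a') / cellSize x z a b) * (armSign a *
    ((∑ a', cellSize x z a' b) / ∑ a', armSize x a') / cellSize x z a b -
      armSign a / armSize x a) * g a b)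
  simp only [coefM, coefR]
  rw [h]
  refine Finset.sum_congr rfl fun a _ => ?_
  rw [Fintype.sum_bool, frac_true hx p, frac_false hx p, cellSize_true (hx a) p,
    cellSize_false (hx a) p]
  have := (hx a).ne'
  have := (h1 a).ne'
  have := (h0 a).ne'
  have hs : armSign a ^ 2 = 1 := by cases a <;> simp
  field_simp
  rw [hs]; ring

end Counts

/-! ### First and second moments of the deviations of `Z` -/

section Deviations

variable {ι : Type*} [Fintype ι] [DecidableEq ι]

theorem wE_armDev (x : ι → Bool) (p : ℝ) (a : Bool) :
    wE (bernWeight fun _ : ι => p) (fun z => armDev x p z a) = 0 :=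
  wE_bern_linear _ _

theorem sum_sq_arm {x : ι → Bool} {a : Bool} (h : 0 < armSize x a) :
    ∑ i, (if x i = a then 1 / armSize x a else 0) ^ 2 = 1 / armSize x a := by
  have e : ∀ i, (if x i = a then 1 / armSize x a else 0) ^ 2 =
      (if x i = a then 1 else 0) * (1 / armSize x a) ^ 2 := fun i => by split_ifs <;> simp
  simp only [e, ← Finset.sum_mul]
  change armSize x a * _ = _
  field_simp

theorem wE_armDev_mul_self {x : ι → Bool} {a : Bool} (h : 0 < armSize x a) (p : ℝ) :
    wE (bernWeight fun _ : ι => p) (fun z => armDev x p z a * armDev x p z a) =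
      p * (1 - p) / armSize x a := by
  have := wE_bern_linear_mul (fun _ : ι => p) (fun i => if x i = a then 1 / armSize x a else 0)
    (fun i => if x i = a then 1 / armSize x a else 0)
  simp only [armDev]
  rw [this, ← Finset.sum_mul]
  simp only [← sq]
  rw [sum_sq_arm h]
  ring

theorem wE_armDev_mul_ne (x : ι → Bool) (p : ℝ) :
    wE (bernWeight fun _ : ι => p) (fun z => armDev x p z true * armDev x p z false) = 0 := by
  have := wE_bern_linear_mul (fun _ : ι => p)
    (fun i => if x i = true then 1 / armSize x true else 0)
    (fun i => if x i = false then 1 / armSize x false else 0)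
  simp only [armDev]
  rw [this]
  refine Finset.sum_eq_zero fun i _ => ?_
  cases x i <;> simp

/-- A common lower bound `n` on the arm sizes gives one estimate for both arms. The arm has at least
one unit, so the coefficients `1 / nₐ` are at most `1 / √nₐ`. -/
theorem wE_armDev_moment_le {x : ι → Bool} {a : Bool} {p n : ℝ} (hn : 0 < n) (h : n ≤ armSize x a)
    (h1 : 1 ≤ armSize x a)
    (hp0 : 0 ≤ p) (hp1 : p ≤ 1) (k : ℕ) :
    wE (bernWeight fun _ : ι => p) (fun z => armDev x p z a ^ (2 * k)) ≤
      momentConst k / n ^ k := by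
  have hpos : 0 < armSize x a := by linarith
  refine (wE_bern_moment_le (n := armSize x a) (fun _ => hp0) (fun _ => hp1) hpos (fun i => ?_)
    (sum_sq_arm hpos).le k).trans ?_
  · have : 1 / armSize x a ≤ 1 / √(armSize x a) := by
      apply one_div_le_one_div_of_le (Real.sqrt_pos.2 hpos)
      rw [Real.sqrt_le_left hpos.le]
      nlinarith
    split_ifs
    · rwa [abs_of_pos (by positivity)]
    · rw [abs_zero]; positivity
  · have := momentConst_pos k
    gcongr

theorem wE_armDev_quad {x : ι → Bool} (hx : ∀ a, 0 < armSize x a) (p s t s' t' : ℝ) :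
    wE (bernWeight fun _ : ι => p) (fun z => (s * armDev x p z true + t * armDev x p z false) *
      (s' * armDev x p z true + t' * armDev x p z false)) =
      p * (1 - p) * (s * s' / armSize x true + t * t' / armSize x false) := by
  have h : (fun z => (s * armDev x p z true + t * armDev x p z false) *
      (s' * armDev x p z true + t' * armDev x p z false)) = fun z =>
      (s * s') * (armDev x p z true * armDev x p z true) +
      ((s * t' + t * s') * (armDev x p z true * armDev x p z false) +
       (t * t') * (armDev x p z false * armDev x p z false)) := by
    funext z; ring
  rw [h, wE_add, wE_add, wE_mul_left, wE_mul_left, wE_mul_left, wE_armDev_mul_self (hx _),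
    wE_armDev_mul_self (hx _), wE_armDev_mul_ne]
  ring

theorem wE_armDev_lin (x : ι → Bool) (p s t : ℝ) :
    wE (bernWeight fun _ : ι => p) (fun z => s * armDev x p z true + t * armDev x p z false) = 0 := by
  rw [wE_add, wE_mul_left, wE_mul_left, wE_armDev, wE_armDev]; ring

theorem totalDev_eq (x : ι → Bool) (p : ℝ) (z : ι → Bool) :
    totalDev x p z = armSize x true / (armSize x true + armSize x false) * armDev x p z true +
      armSize x false / (armSize x true + armSize x false) * armDev x p z false := by
  simp only [totalDev, Fintype.sum_bool]; ring

theorem totalDev_sub_true {x : ι → Bool} (hx : ∀ a, 0 < armSize x a) (p : ℝ) (z : ι → Bool) :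
    totalDev x p z - armDev x p z true =
      armSize x false / (armSize x true + armSize x false) *
        (armDev x p z false - armDev x p z true) := by
  have h0 := hx false
  have h1 := hx true
  rw [totalDev_eq]; field_simp; ring

theorem totalDev_sub_false {x : ι → Bool} (hx : ∀ a, 0 < armSize x a) (p : ℝ) (z : ι → Bool) :
    totalDev x p z - armDev x p z false =
      armSize x true / (armSize x true + armSize x false) *
        (armDev x p z true - armDev x p z false) := by
  have h0 := hx false
  have h1 := hx true
  rw [totalDev_eq]; field_simp; ring

/-- The pooled deviation is a weighted mean of those of the arms, so `t - uₐ` is their difference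
times the relative size of the other arm, up to sign. -/
theorem sq_totalDev_sub_le {x : ι → Bool} (hx : ∀ a, 0 < armSize x a) (p : ℝ) (z : ι → Bool)
    (a : Bool) : (totalDev x p z - armDev x p z a) ^ 2 ≤
      2 * (armDev x p z true ^ 2 + armDev x p z false ^ 2) := by
  have h0 := hx false
  have h1 := hx true
  have key : ∀ s u v : ℝ, 0 ≤ s → s ≤ 1 → (s * (u - v)) ^ 2 ≤ 2 * (u ^ 2 + v ^ 2) := by
    intro s u v hs hs1
    have : s ^ 2 ≤ 1 := by nlinarith
    calc (s * (u - v)) ^ 2 = s ^ 2 * (u - v) ^ 2 := by ring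
      _ ≤ 1 * (u - v) ^ 2 := by gcongr
      _ ≤ _ := by nlinarith [sq_nonneg (u + v)]
  cases a
  · rw [totalDev_sub_false hx]
    refine key _ _ _ (by positivity) ?_
    rw [div_le_one (by positivity)]; linarith
  · rw [totalDev_sub_true hx, add_comm (armDev x p z true ^ 2)]
    refine key _ _ _ (by positivity) ?_
    rw [div_le_one (by positivity)]; linarith

/-- The centred conditional mean of `R` given `Z`. -/
noncomputable def meanDevR (C D : ℝ) (x : ι → Bool) (p : ℝ) (z : ι → Bool) : ℝ :=
  (2 * C - D) * armDev x p z true + -(2 * C + D) * armDev x p z false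

/-- The centred conditional mean of `M` given `Z`, when no cell is empty. -/
noncomputable def meanDevM (D : ℝ) (x : ι → Bool) (p : ℝ) (z : ι → Bool) : ℝ :=
  -2 * D * totalDev x p z

theorem meanDevM_eq (D : ℝ) (x : ι → Bool) (p : ℝ) (z : ι → Bool) : meanDevM D x p z =
    (-2 * D * (armSize x true / (armSize x true + armSize x false))) * armDev x p z true +
      (-2 * D * (armSize x false / (armSize x true + armSize x false))) * armDev x p z false := by
  rw [meanDevM, totalDev_eq]; ring

theorem wE_meanDevR (C D : ℝ) (x : ι → Bool) (p : ℝ) :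
    wE (bernWeight fun _ : ι => p) (meanDevR C D x p) = 0 :=
  wE_armDev_lin x p _ _

theorem wE_meanDevM (D : ℝ) (x : ι → Bool) (p : ℝ) :
    wE (bernWeight fun _ : ι => p) (meanDevM D x p) = 0 := by
  have : meanDevM D x p = _ := funext fun z => meanDevM_eq D x p z
  rw [this]
  exact wE_armDev_lin x p _ _

/-- Exact, with no error term: the difference of the centred means is `-(2C + (2ξ - 1)D)(u₁ - u₀)`,
and the variance of `u₁ - u₀` is `p(1 - p)(1/n₁ + 1/n₀)`. -/
theorem wE_meanDevR_mul {x : ι → Bool} (hx : ∀ a, 0 < armSize x a) (C D p : ℝ) :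
    wE (bernWeight fun _ : ι => p)
      (fun z => meanDevR C D x p z * (meanDevM D x p z - meanDevR C D x p z)) =
      -(VStructure.leadR p C D (armSize x true / (armSize x true + armSize x false)) /
        (armSize x true + armSize x false)) := by
  have h0 := hx false
  have h1 := hx true
  have h : ∀ z, meanDevM D x p z - meanDevR C D x p z =
    (-2 * D * (armSize x true / (armSize x true + armSize x false)) - (2 * C - D)) *
      armDev x p z true +
      (-2 * D * (armSize x false / (armSize x true + armSize x false)) - -(2 * C + D)) *
      armDev x p z false := fun z => by rw [meanDevM_eq, meanDevR]; ring
  simp only [h]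
  simp only [meanDevR]
  rw [wE_armDev_quad hx, VStructure.leadR]
  have e : 1 - armSize x true / (armSize x true + armSize x false) =
    armSize x false / (armSize x true + armSize x false) := by field_simp; ring
  rw [e]
  field_simp; ring

/-- The first factor is a multiple of the pooled deviation and the second a multiple of `u₁ - u₀`;
weighting by arm sizes makes these uncorrelated. This is why `L_R` is absent from the expansion of
`C[R,M] - V[M]`. -/
theorem wE_meanDevM_mul {x : ι → Bool} (hx : ∀ a, 0 < armSize x a) (C D p : ℝ) :
    wE (bernWeight fun _ : ι => p)
      (fun z => meanDevM D x p z * (meanDevM D x p z - meanDevR C D x p z)) = 0 := by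
  have h0 := hx false
  have h1 := hx true
  have h : ∀ z, meanDevM D x p z - meanDevR C D x p z =
    (-2 * D * (armSize x true / (armSize x true + armSize x false)) - (2 * C - D)) *
      armDev x p z true +
      (-2 * D * (armSize x false / (armSize x true + armSize x false)) - -(2 * C + D)) *
      armDev x p z false := fun z => by rw [meanDevM_eq, meanDevR]; ring
  simp only [h]
  simp only [meanDevM_eq]
  rw [wE_armDev_quad hx]
  field_simp; ring

theorem wE_totalDev_sub (x : ι → Bool) (p : ℝ) (g : Bool → ℝ) :
    wE (bernWeight fun _ : ι => p)
      (fun z => ∑ a, g a * (totalDev x p z - armDev x p z a)) = 0 := by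
  have h : ∀ z, ∑ a, g a * (totalDev x p z - armDev x p z a) =
    (armSize x true / (armSize x true + armSize x false) * (g true + g false) - g true) *
      armDev x p z true +
    (armSize x false / (armSize x true + armSize x false) * (g true + g false) - g false) *
      armDev x p z false := fun z => by rw [Fintype.sum_bool, totalDev_eq]; ring
  simp only [h]
  exact wE_armDev_lin x p _ _

/-- The leading random term of the conditional covariance of `M` and `M - R`. -/
noncomputable def mainTerm (q₀ q₁ : ℝ) (x : ι → Bool) (p : ℝ) (z : ι → Bool) : ℝ :=
  ∑ a, 1 / armSize x a * ((totalDev x p z - armDev x p z a) ^ 2 *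
    ((if a then q₁ * (1 - q₁) else q₀ * (1 - q₀)) * (1 / p + 1 / (1 - p))))

/-- Each square is a multiple of `(u₁ - u₀)²`, and the factor `p(1 - p)` in its expectation cancels
against `1/p + 1/(1 - p)`. -/
theorem wE_mainTerm {x : ι → Bool} (hx : ∀ a, 0 < armSize x a) (q₀ q₁ : ℝ) {p : ℝ} (hp0 : 0 < p)
    (hp1 : p < 1) : wE (bernWeight fun _ : ι => p) (mainTerm q₀ q₁ x p) =
      VStructure.leadM q₀ q₁ (armSize x true + armSize x false)
        (armSize x true / (armSize x true + armSize x false)) /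
          (armSize x true + armSize x false) := by
  have h0 := hx false
  have h1 := hx true
  have hp1' : 0 < 1 - p := by linarith
  have e1 : ∀ z, (totalDev x p z - armDev x p z true) ^ 2 =
    (armSize x false / (armSize x true + armSize x false)) ^ 2 *
      ((1 * armDev x p z true + (-1) * armDev x p z false) *
        (1 * armDev x p z true + (-1) * armDev x p z false)) := fun z => by
    rw [totalDev_sub_true hx]; ring
  have e0 : ∀ z, (totalDev x p z - armDev x p z false) ^ 2 =
    (armSize x true / (armSize x true + armSize x false)) ^ 2 *
      ((1 * armDev x p z true + (-1) * armDev x p z false) *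
        (1 * armDev x p z true + (-1) * armDev x p z false)) := fun z => by
    rw [totalDev_sub_false hx]; ring
  have h : mainTerm q₀ q₁ x p = fun z =>
    ((1 / armSize x true) * (q₁ * (1 - q₁) * (1 / p + 1 / (1 - p))) *
      (armSize x false / (armSize x true + armSize x false)) ^ 2 +
     (1 / armSize x false) * (q₀ * (1 - q₀) * (1 / p + 1 / (1 - p))) *
      (armSize x true / (armSize x true + armSize x false)) ^ 2) *
      ((1 * armDev x p z true + (-1) * armDev x p z false) *
        (1 * armDev x p z true + (-1) * armDev x p z false)) := by
    funext z
    rw [mainTerm, Fintype.sum_bool, e1, e0]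
    simp only [if_true, Bool.false_eq_true, if_false]
    ring
  rw [h, wE_mul_left, wE_armDev_quad hx, VStructure.leadM]
  have e : 1 - armSize x true / (armSize x true + armSize x false) =
    armSize x false / (armSize x true + armSize x false) := by field_simp; ring
  rw [e]
  field_simp; ring

end Deviations

/-! ### Conditional means and covariances given `X` and `Z` -/

section Fixed

variable {ι : Type*} [Fintype ι] [DecidableEq ι]

/-- The weights of `Y` given `X = x` and `Z = z`. -/
def outcomeWeight (pY : Bool → Bool → ℝ) (x z : ι → Bool) : (ι → Bool) → ℝ :=
  bernWeight fun i => pY (x i) (z i)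

theorem isWeight_outcome {pY : Bool → Bool → ℝ} (h : VStructure.ValidTable pY) (x z : ι → Bool) :
    IsWeight (outcomeWeight pY x z) :=
  isWeight_bern (fun i => (h (x i) (z i)).1) (fun i => (h (x i) (z i)).2)

/-- The expectation of a function of `Z` and `Y` when `X = x` is fixed. -/
def armExp (x : ι → Bool) (p : ℝ) (pY : Bool → Bool → ℝ)
    (f : (ι → Bool) → (ι → Bool) → ℝ) : ℝ :=
  wE (bernWeight fun _ : ι => p) fun z => wE (outcomeWeight pY x z) (f z)

/-- The covariance of two functions of `Z` and `Y` when `X = x` is fixed. -/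
def armCov (x : ι → Bool) (p : ℝ) (pY : Bool → Bool → ℝ)
    (f g : (ι → Bool) → (ι → Bool) → ℝ) : ℝ :=
  armExp x p pY (fun z y => f z y * g z y) - armExp x p pY f * armExp x p pY g

/-- The law of total covariance, conditioning on `Z`. -/
theorem armCov_eq (x : ι → Bool) (p : ℝ) (pY : Bool → Bool → ℝ)
    (f g : (ι → Bool) → (ι → Bool) → ℝ) : armCov x p pY f g =
      wE (bernWeight fun _ : ι => p) (fun z => wCov (outcomeWeight pY x z) (f z) (g z)) +
      wCov (bernWeight fun _ : ι => p) (fun z => wE (outcomeWeight pY x z) (f z))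
        (fun z => wE (outcomeWeight pY x z) (g z)) := by
  simp only [armCov, armExp, wCov, wE_sub]; ring

/-- The estimator `R` as a function of the three assignments. -/
noncomputable def rEst (x z y : ι → Bool) : ℝ := VStructure.estR (tripleCount x z y)

/-- The estimator `M` as a function of the three assignments. -/
noncomputable def mEst (x z y : ι → Bool) : ℝ := VStructure.estM (tripleCount x z y)

theorem abs_rEst_le (x z y : ι → Bool) : |rEst x z y| ≤ 1 := abs_estR_le _
theorem abs_mEst_le (x z y : ι → Bool) : |mEst x z y| ≤ 1 := abs_estM_le _

theorem abs_mEst_sub_rEst_le (x z y : ι → Bool) : |mEst x z y - rEst x z y| ≤ 2 := by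
  have := abs_sub (mEst x z y) (rEst x z y)
  linarith [abs_rEst_le x z y, abs_mEst_le x z y]

theorem tableY_true_sub (p q₀ q₁ C D : ℝ) : VStructure.tableY p q₀ q₁ C D true true -
    VStructure.tableY p q₀ q₁ C D true false = 2 * C - D := by
  simp [VStructure.tableY]; ring

theorem tableY_false_sub (p q₀ q₁ C D : ℝ) : VStructure.tableY p q₀ q₁ C D false true -
    VStructure.tableY p q₀ q₁ C D false false = 2 * C + D := by
  simp [VStructure.tableY]; ring

/-- Both slopes are differences of two probabilities, and `2D` is the difference of the slopes. -/
theorem abs_slopes_le {p q₀ q₁ C D : ℝ}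
    (h : VStructure.ValidTable (VStructure.tableY p q₀ q₁ C D)) :
    |2 * C - D| ≤ 1 ∧ |2 * C + D| ≤ 1 ∧ |D| ≤ 1 := by
  have h1 := tableY_true_sub p q₀ q₁ C D
  have h0 := tableY_false_sub p q₀ q₁ C D
  have a1 := h true true
  have a2 := h true false
  have a3 := h false true
  have a4 := h false false
  refine ⟨?_, ?_, ?_⟩ <;> rw [abs_le] <;> constructor <;> linarith [a1.1, a1.2, a2.1, a2.2, a3.1,
    a3.2, a4.1, a4.2]

theorem wE_rEst {x : ι → Bool} (hx : ∀ a, 0 < armSize x a) {p q₀ q₁ C D : ℝ}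
    (h : VStructure.ValidTable (VStructure.tableY p q₀ q₁ C D)) (z : ι → Bool) :
    wE (outcomeWeight (VStructure.tableY p q₀ q₁ C D) x z) (rEst x z) =
      (q₁ - q₀) + meanDevR C D x p z := by
  have e : rEst x z = fun y => ∑ i, coefR x i * bval (y i) := funext fun y => estR_tripleCount x z y
  rw [e, outcomeWeight, wE_bern_val (isWeight_outcome h x z),
    sum_coefR_mul hx p z (VStructure.tableY p q₀ q₁ C D), meanDevR]
  simp [VStructure.tableY]; ring

/-- Half of the smaller of `p` and `1 - p`. -/
noncomputable def halfMargin (p : ℝ) : ℝ := min p (1 - p) / 2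

theorem halfMargin_pos {p : ℝ} (hp0 : 0 < p) (hp1 : p < 1) : 0 < halfMargin p := by
  have : 0 < min p (1 - p) := lt_min hp0 (by linarith)
  unfold halfMargin; linarith

theorem two_halfMargin_le (p : ℝ) : 2 * halfMargin p ≤ p ∧ 2 * halfMargin p ≤ 1 - p := by
  have h1 := min_le_left p (1 - p)
  have h2 := min_le_right p (1 - p)
  unfold halfMargin; constructor <;> linarith

/-- A nonnegative function that is at least one when some deviation is large. -/
noncomputable def badness (x : ι → Bool) (p : ℝ) (z : ι → Bool) : ℝ :=
  (armDev x p z true ^ 6 + armDev x p z false ^ 6) / halfMargin p ^ 6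

theorem even_six_nonneg (u : ℝ) : 0 ≤ u ^ 6 := Even.pow_nonneg ⟨3, rfl⟩ u

theorem badness_nonneg (x : ι → Bool) (p : ℝ) (z : ι → Bool) : 0 ≤ badness x p z :=
  div_nonneg (add_nonneg (even_six_nonneg _) (even_six_nonneg _)) (even_six_nonneg _)

/-- Dominating the indicator of the bad event by moments replaces a separate tail estimate. -/
theorem one_le_badness {x : ι → Bool} {p : ℝ} {z : ι → Bool} (hp0 : 0 < p) (hp1 : p < 1)
    (h : ¬ ∀ a, |armDev x p z a| ≤ halfMargin p) : 1 ≤ badness x p z := by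
  have hγ := halfMargin_pos hp0 hp1
  rw [badness, one_le_div (by positivity)]
  push Not at h
  obtain ⟨a, ha⟩ := h
  have h6 : halfMargin p ^ 6 ≤ armDev x p z a ^ 6 := by
    have := pow_le_pow_left₀ hγ.le ha.le 6
    rwa [Even.pow_abs ⟨3, rfl⟩] at this
  have h1 := even_six_nonneg (armDev x p z true)
  have h2 := even_six_nonneg (armDev x p z false)
  cases a <;> linarith

theorem fractions_pos {x : ι → Bool} {p : ℝ} {z : ι → Bool}
    (h : ∀ a, |armDev x p z a| ≤ halfMargin p) :
    (∀ a, halfMargin p ≤ p + armDev x p z a) ∧ ∀ a, halfMargin p ≤ 1 - p - armDev x p z a := by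
  have h2 := two_halfMargin_le p
  constructor <;> intro a <;> have := abs_le.1 (h a) <;> linarith [this.1, this.2]

/-- Splits every later estimate: the fine bound `r` serves when both deviations are within the
margin, and the crude bound `c` is paid only where `badness` is at least 1. -/
theorem le_mul_badness {x : ι → Bool} {p : ℝ} {z : ι → Bool} (hp0 : 0 < p) (hp1 : p < 1) {u c r : ℝ}
    (hr : 0 ≤ r) (hc : 0 ≤ c)
    (hu : u ≤ c) (h : (∀ a, |armDev x p z a| ≤ halfMargin p) → u ≤ r) :
    u ≤ c * badness x p z + r := by
  by_cases hg : ∀ a, |armDev x p z a| ≤ halfMargin p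
  · have := h hg
    have := mul_nonneg hc (badness_nonneg x p z)
    linarith
  · have := one_le_badness hp0 hp1 hg
    nlinarith

theorem abs_totalDev_le {x : ι → Bool} (hx : ∀ a, 0 < armSize x a) {p : ℝ} (hp0 : 0 ≤ p)
    (hp1 : p ≤ 1) (z : ι → Bool) : |totalDev x p z| ≤ 1 := by
  have h0 := hx false
  have h1 := hx true
  have a1 := abs_le.1 (abs_armDev_le h1 hp0 hp1 z)
  have a0 := abs_le.1 (abs_armDev_le h0 hp0 hp1 z)
  simp only [totalDev, Fintype.sum_bool]
  rw [abs_le, le_div_iff₀ (by positivity), div_le_iff₀ (by positivity)]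
  constructor <;> nlinarith [a1.1, a1.2, a0.1, a0.2]

theorem abs_meanDevM_le {x : ι → Bool} (hx : ∀ a, 0 < armSize x a) {p D : ℝ} (hp0 : 0 ≤ p)
    (hp1 : p ≤ 1) (hD : |D| ≤ 1) (z : ι → Bool) : |meanDevM D x p z| ≤ 2 := by
  rw [meanDevM, abs_mul, abs_mul, abs_neg, abs_two]
  have := abs_totalDev_le hx hp0 hp1 z
  have := mul_le_mul hD this (abs_nonneg _) zero_le_one
  linarith

theorem abs_meanDevR_le {x : ι → Bool} (hx : ∀ a, 0 < armSize x a) {p C D : ℝ} (hp0 : 0 ≤ p)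
    (hp1 : p ≤ 1) (h1 : |2 * C - D| ≤ 1) (h0 : |2 * C + D| ≤ 1) (z : ι → Bool) :
    |meanDevR C D x p z| ≤ 2 := by
  have a1 := mul_le_mul h1 (abs_armDev_le (hx true) hp0 hp1 z) (abs_nonneg _) zero_le_one
  have a0 := mul_le_mul h0 (abs_armDev_le (hx false) hp0 hp1 z) (abs_nonneg _) zero_le_one
  rw [← abs_mul] at a1 a0
  have := abs_sub ((2 * C - D) * armDev x p z true) ((2 * C + D) * armDev x p z false)
  rw [meanDevR, neg_mul, ← sub_eq_add_neg]
  linarith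

/-- Within the margin no cell is empty and the difference vanishes exactly. Otherwise the crude
bound is `1 + 1 + 2 = 4`. -/
theorem abs_wE_mEst_sub_le {x : ι → Bool} (hx : ∀ a, 0 < armSize x a) {p q₀ q₁ C D : ℝ}
    (hp0 : 0 < p) (hp1 : p < 1) (hq₀ : 0 ≤ q₀ ∧ q₀ ≤ 1) (hq₁ : 0 ≤ q₁ ∧ q₁ ≤ 1)
    (h : VStructure.ValidTable (VStructure.tableY p q₀ q₁ C D)) (z : ι → Bool) :
    |wE (outcomeWeight (VStructure.tableY p q₀ q₁ C D) x z) (mEst x z) - (q₁ - q₀) -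
      meanDevM D x p z| ≤ 4 * badness x p z := by
  have key := le_mul_badness (x := x) (p := p) (z := z) (c := 4) (r := 0) hp0 hp1 le_rfl (by norm_num)
    (u := |wE (outcomeWeight (VStructure.tableY p q₀ q₁ C D) x z) (mEst x z) - (q₁ - q₀) -
      meanDevM D x p z|) ?_ ?_
  · linarith
  · have b1 := abs_wE_le_const (isWeight_outcome h x z) (abs_mEst_le x z)
    have b2 := abs_meanDevM_le hx hp0.le hp1.le (abs_slopes_le h).2.2 z
    rw [abs_le] at b1 b2 ⊢
    constructor <;> linarith [b1.1, b1.2, b2.1, b2.2, hq₀.1, hq₀.2, hq₁.1, hq₁.2]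
  · intro hg
    obtain ⟨g1, g0⟩ := fractions_pos hg
    have hγ := halfMargin_pos hp0 hp1
    have e : mEst x z = fun y => ∑ i, coefM x z i * bval (y i) :=
      funext fun y => estM_tripleCount x z y
    rw [e, outcomeWeight, wE_bern_val (isWeight_outcome h x z),
      sum_coefM_mul hx (fun a => hγ.trans_le (g1 a)) (fun a => hγ.trans_le (g0 a))
        (VStructure.tableY p q₀ q₁ C D), meanDevM]
    apply le_of_eq
    rw [abs_eq_zero]
    simp [VStructure.tableY]; ring

/-- The variance of `Y` given `X` and `Z`. -/
def cellVar (pY : Bool → Bool → ℝ) (a b : Bool) : ℝ := pY a b * (1 - pY a b)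

theorem cellVar_mem {pY : Bool → Bool → ℝ} (h : VStructure.ValidTable pY) (a b : Bool) :
    0 ≤ cellVar pY a b ∧ cellVar pY a b ≤ 1 := by
  have := h a b
  unfold cellVar
  constructor <;> nlinarith [this.1, this.2]

/-- The conditional covariance terms of mean zero. -/
noncomputable def linearTerm (pY : Bool → Bool → ℝ) (x : ι → Bool) (p : ℝ) (z : ι → Bool) : ℝ :=
  ∑ a, 1 / armSize x a *
    ((cellVar pY a true - cellVar pY a false) * (totalDev x p z - armDev x p z a))

theorem wE_linearTerm (pY : Bool → Bool → ℝ) (x : ι → Bool) (p : ℝ) :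
    wE (bernWeight fun _ : ι => p) (linearTerm pY x p) = 0 := by
  have := wE_totalDev_sub x p
    (fun a => 1 / armSize x a * (cellVar pY a true - cellVar pY a false))
  simp only [mul_assoc] at this
  exact this

theorem sq_totalDev_sub_le_four {x : ι → Bool} (hx : ∀ a, 0 < armSize x a) {p : ℝ} (hp0 : 0 ≤ p)
    (hp1 : p ≤ 1) (z : ι → Bool) (a : Bool) : (totalDev x p z - armDev x p z a) ^ 2 ≤ 4 := by
  have h := sq_totalDev_sub_le hx p z a
  have a1 := (sq_le_one_iff_abs_le_one _).2 (abs_armDev_le (hx true) hp0 hp1 z)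
  have a0 := (sq_le_one_iff_abs_le_one _).2 (abs_armDev_le (hx false) hp0 hp1 z)
  linarith

theorem abs_linearTerm_le {x : ι → Bool} (hx : ∀ a, 1 ≤ armSize x a) {pY : Bool → Bool → ℝ}
    (h : VStructure.ValidTable pY) {p : ℝ} (hp0 : 0 ≤ p) (hp1 : p ≤ 1) (z : ι → Bool) :
    |linearTerm pY x p z| ≤ 4 := by
  have hx' : ∀ a, 0 < armSize x a := fun a => zero_lt_one.trans_le (hx a)
  have key : ∀ a, |1 / armSize x a * ((cellVar pY a true - cellVar pY a false) *
      (totalDev x p z - armDev x p z a))| ≤ 2 := by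
    intro a
    have h1 : |1 / armSize x a| ≤ 1 := by
      rw [abs_of_pos (one_div_pos.2 (hx' a)), div_le_one (hx' a)]; exact hx a
    have h2 : |cellVar pY a true - cellVar pY a false| ≤ 1 := by
      have := cellVar_mem h a true
      have := cellVar_mem h a false
      rw [abs_le]; constructor <;> linarith
    have h3 : |totalDev x p z - armDev x p z a| ≤ 2 :=
      abs_le_of_sq_le_sq (by linarith [sq_totalDev_sub_le_four hx' hp0 hp1 z a]) (by norm_num)
    rw [abs_mul, abs_mul]
    calc _ ≤ 1 * (1 * 2 : ℝ) := by gcongr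
      _ = 2 := by norm_num
  have := Finset.abs_sum_le_sum_abs (fun a => 1 / armSize x a *
    ((cellVar pY a true - cellVar pY a false) * (totalDev x p z - armDev x p z a))) Finset.univ
  rw [← linearTerm, Fintype.sum_bool] at this
  linarith [key true, key false]

theorem rEst_eq (x z : ι → Bool) : rEst x z = fun y => ∑ i, coefR x i * bval (y i) :=
  funext fun y => estR_tripleCount x z y

theorem mEst_eq (x z : ι → Bool) : mEst x z = fun y => ∑ i, coefM x z i * bval (y i) :=
  funext fun y => estM_tripleCount x z y

theorem mEst_sub_rEst_eq (x z : ι → Bool) : (fun y => mEst x z y - rEst x z y) =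
    fun y => ∑ i, (coefM x z i - coefR x i) * bval (y i) := by
  funext y
  rw [rEst_eq, mEst_eq]
  simp only [sub_mul, Finset.sum_sub_distrib]

/-- Again an exact identity within the margin; the constant is 4 for the covariance plus 4 for the
linear term. -/
theorem abs_wCov_rEst_sub_le {x : ι → Bool} (hx : ∀ a, 1 ≤ armSize x a) {pY : Bool → Bool → ℝ}
    (h : VStructure.ValidTable pY) {p : ℝ} (hp0 : 0 < p) (hp1 : p < 1) (z : ι → Bool) :
    |wCov (outcomeWeight pY x z) (rEst x z) (fun y => mEst x z y - rEst x z y) -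
      linearTerm pY x p z| ≤ 8 * badness x p z := by
  have hx' : ∀ a, 0 < armSize x a := fun a => zero_lt_one.trans_le (hx a)
  have key := le_mul_badness (x := x) (p := p) (z := z) (c := 8) (r := 0) hp0 hp1 le_rfl (by norm_num)
    (u := |wCov (outcomeWeight pY x z) (rEst x z) (fun y => mEst x z y - rEst x z y) -
      linearTerm pY x p z|) ?_ ?_
  · linarith
  · have b1 := abs_wCov_le (isWeight_outcome h x z) (abs_rEst_le x z) (abs_mEst_sub_rEst_le x z)
      zero_le_one
    have b2 := abs_linearTerm_le hx h hp0.le hp1.le z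
    rw [abs_le] at b1 b2 ⊢
    constructor <;> linarith [b1.1, b1.2, b2.1, b2.2]
  · intro hg
    obtain ⟨g1, g0⟩ := fractions_pos hg
    have hγ := halfMargin_pos hp0 hp1
    have e := sum_coefR_mul_sub hx' (fun a => hγ.trans_le (g1 a)) (fun a => hγ.trans_le (g0 a))
      (cellVar pY)
    rw [mEst_sub_rEst_eq, rEst_eq, outcomeWeight, wCov_bern_val (isWeight_outcome h x z)]
    simp only [cellVar] at e
    rw [e]
    simp only [linearTerm, cellVar, sub_self, abs_zero, le_refl]

/-- The pointwise bound for the conditional covariance of `M` and `M - R`. -/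
noncomputable def quadError (η : ℝ) (x : ι → Bool) (p : ℝ) (z : ι → Bool) : ℝ :=
  ∑ a, 1 / armSize x a * ((totalDev x p z - armDev x p z a) ^ 2 *
    (η / halfMargin p + |armDev x p z a| / halfMargin p ^ 2))

/-- Splits the error into moving the denominator from `s'` to `s` and the numerator from `v` to `Q`;
used with `s` being `p` or `1 - p` and `s'` its empirical counterpart. -/
theorem abs_div_sub_div_le {γ s s' v Q η : ℝ} (hγ : 0 < γ) (hs : 2 * γ ≤ s) (hs' : γ ≤ s')
    (hv : |v| ≤ 1) (hQ : |v - Q| ≤ η) :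
    |v / s' - Q / s| ≤ |s' - s| / (2 * γ ^ 2) + η / (2 * γ) := by
  have p1 : 0 < s := by linarith
  have p2 : 0 < s' := by linarith
  have e : v / s' - Q / s = v * (s - s') / (s' * s) + (v - Q) / s := by field_simp; ring
  rw [e]
  refine (abs_add_le _ _).trans (add_le_add ?_ ?_)
  · rw [abs_div, abs_mul, abs_of_pos (mul_pos p2 p1), abs_sub_comm]
    calc |v| * |s' - s| / (s' * s) ≤ 1 * |s' - s| / (γ * (2 * γ)) := by gcongr
      _ = _ := by ring
  · rw [abs_div, abs_of_pos p1]
    have : 0 ≤ η := (abs_nonneg _).trans hQ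
    gcongr

theorem abs_tableY_sub_le {p : ℝ} (hp0 : 0 < p) (hp1 : p < 1) (q₀ q₁ C D : ℝ) (a b : Bool) :
    |VStructure.tableY p q₀ q₁ C D a b - (if a then q₁ else q₀)| ≤ |C| + |D| := by
  have h1 : |D * p| ≤ |D| := by
    rw [abs_mul, abs_of_pos hp0]; nlinarith [abs_nonneg D]
  have h2 : |D * (1 - p)| ≤ |D| := by
    rw [abs_mul, abs_of_pos (by linarith : 0 < 1 - p)]; nlinarith [abs_nonneg D]
  have h3 := abs_le.1 h1
  have h4 := abs_le.1 h2
  have h5 := abs_le.1 (le_refl |C|)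
  rw [abs_le]
  cases a <;> cases b <;> simp only [VStructure.tableY, if_true, Bool.false_eq_true, if_false] <;>
    constructor <;> linarith [h3.1, h3.2, h4.1, h4.2, h5.1, h5.2]

/-- The map `u ↦ u(1 - u)` is 1-Lipschitz on the unit interval. -/
theorem abs_cellVar_sub_le {p q₀ q₁ C D : ℝ} (hp0 : 0 < p) (hp1 : p < 1)
    (hq₀ : 0 ≤ q₀ ∧ q₀ ≤ 1) (hq₁ : 0 ≤ q₁ ∧ q₁ ≤ 1)
    (h : VStructure.ValidTable (VStructure.tableY p q₀ q₁ C D)) (a b : Bool) :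
    |cellVar (VStructure.tableY p q₀ q₁ C D) a b -
      (if a then q₁ * (1 - q₁) else q₀ * (1 - q₀))| ≤ |C| + |D| := by
  have key : ∀ u q : ℝ, 0 ≤ u ∧ u ≤ 1 → 0 ≤ q ∧ q ≤ 1 →
      |u * (1 - u) - q * (1 - q)| ≤ |u - q| := by
    intro u q hu hq
    have e : u * (1 - u) - q * (1 - q) = (u - q) * (1 - u - q) := by ring
    rw [e, abs_mul]
    refine mul_le_of_le_one_right (abs_nonneg _) ?_
    rw [abs_le]; constructor <;> linarith [hu.1, hu.2, hq.1, hq.2]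
  have h1 := abs_tableY_sub_le hp0 hp1 q₀ q₁ C D a b
  cases a
  · exact (key _ _ (h false b) hq₀).trans h1
  · exact (key _ _ (h true b) hq₁).trans h1

theorem abs_mainTerm_le {x : ι → Bool} (hx : ∀ a, 1 ≤ armSize x a) {p q₀ q₁ : ℝ} (hp0 : 0 < p)
    (hp1 : p < 1) (hq₀ : 0 ≤ q₀ ∧ q₀ ≤ 1) (hq₁ : 0 ≤ q₁ ∧ q₁ ≤ 1) (z : ι → Bool) :
    |mainTerm q₀ q₁ x p z| ≤ 8 / halfMargin p := by
  have hx' : ∀ a, 0 < armSize x a := fun a => zero_lt_one.trans_le (hx a)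
  have hγ := halfMargin_pos hp0 hp1
  have hm := two_halfMargin_le p
  have hp1' : 0 < 1 - p := by linarith
  have hs : 1 / p + 1 / (1 - p) ≤ 1 / halfMargin p := by
    calc 1 / p + 1 / (1 - p) ≤ 1 / (2 * halfMargin p) + 1 / (2 * halfMargin p) := by
          gcongr; exacts [hm.1, hm.2]
      _ = _ := by field_simp; norm_num
  have hQ : ∀ a : Bool, 0 ≤ (if a then q₁ * (1 - q₁) else q₀ * (1 - q₀)) ∧
      (if a then q₁ * (1 - q₁) else q₀ * (1 - q₀)) ≤ 1 := by
    intro a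
    split_ifs
    · constructor <;> nlinarith [hq₁.1, hq₁.2]
    · constructor <;> nlinarith [hq₀.1, hq₀.2]
  have key : ∀ a, 0 ≤ 1 / armSize x a * ((totalDev x p z - armDev x p z a) ^ 2 *
    ((if a then q₁ * (1 - q₁) else q₀ * (1 - q₀)) * (1 / p + 1 / (1 - p)))) ∧
    1 / armSize x a * ((totalDev x p z - armDev x p z a) ^ 2 *
    ((if a then q₁ * (1 - q₁) else q₀ * (1 - q₀)) * (1 / p + 1 / (1 - p)))) ≤
      4 / halfMargin p := by
    intro a
    have hT := sq_totalDev_sub_le_four hx' hp0.le hp1.le z a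
    have hQ1 := (hQ a).1
    have hQ2 := (hQ a).2
    have ha := hx' a
    have h1 : 1 / armSize x a ≤ 1 := by rw [div_le_one ha]; exact hx a
    refine ⟨by positivity, ?_⟩
    calc _ ≤ 1 * (4 * (1 * (1 / halfMargin p))) := by gcongr
      _ = _ := by ring
  rw [mainTerm, Fintype.sum_bool, abs_of_nonneg (add_nonneg (key true).1 (key false).1)]
  have := (key true).2
  have := (key false).2
  have e : 8 / halfMargin p = 4 / halfMargin p + 4 / halfMargin p := by ring
  linarith

theorem quadError_nonneg {x : ι → Bool} {η p : ℝ} (hη : 0 ≤ η) (hp0 : 0 < p) (hp1 : p < 1)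
    (z : ι → Bool) : 0 ≤ quadError η x p z := by
  have hγ := halfMargin_pos hp0 hp1
  refine Finset.sum_nonneg fun a _ => ?_
  have := armSize_nonneg x a
  positivity

/-- Within the margin the linear terms cancel exactly, and what remains is the effect on the
quadratic term of replacing cell variances and denominators by their limits. -/
theorem abs_wCov_mEst_sub_le {x : ι → Bool} (hx : ∀ a, 1 ≤ armSize x a) {p q₀ q₁ C D : ℝ}
    (hp0 : 0 < p) (hp1 : p < 1) (hq₀ : 0 ≤ q₀ ∧ q₀ ≤ 1) (hq₁ : 0 ≤ q₁ ∧ q₁ ≤ 1)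
    (h : VStructure.ValidTable (VStructure.tableY p q₀ q₁ C D)) (z : ι → Bool) :
    |wCov (outcomeWeight (VStructure.tableY p q₀ q₁ C D) x z) (mEst x z)
        (fun y => mEst x z y - rEst x z y) -
      (linearTerm (VStructure.tableY p q₀ q₁ C D) x p z + mainTerm q₀ q₁ x p z)| ≤
      (8 + 8 / halfMargin p) * badness x p z + quadError (|C| + |D|) x p z := by
  have hx' : ∀ a, 0 < armSize x a := fun a => zero_lt_one.trans_le (hx a)
  have hγ := halfMargin_pos hp0 hp1
  have hm := two_halfMargin_le p
  refine le_mul_badness hp0 hp1 (quadError_nonneg (by positivity) hp0 hp1 z) (by positivity) ?_ ?_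
  · have b1 := abs_wCov_le (isWeight_outcome h x z) (abs_mEst_le x z) (abs_mEst_sub_rEst_le x z)
      zero_le_one
    have b2 := abs_linearTerm_le hx h hp0.le hp1.le z
    have b3 := abs_mainTerm_le hx hp0 hp1 hq₀ hq₁ z
    rw [abs_le] at b1 b2 b3 ⊢
    constructor <;> linarith [b1.1, b1.2, b2.1, b2.2, b3.1, b3.2]
  · intro hg
    obtain ⟨g1, g0⟩ := fractions_pos hg
    have e := sum_coefM_mul_sub hx' (fun a => hγ.trans_le (g1 a)) (fun a => hγ.trans_le (g0 a))
      (cellVar (VStructure.tableY p q₀ q₁ C D))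
    have e2 : wCov (outcomeWeight (VStructure.tableY p q₀ q₁ C D) x z) (mEst x z)
        (fun y => mEst x z y - rEst x z y) = ∑ i, coefM x z i * (coefM x z i - coefR x i) *
          cellVar (VStructure.tableY p q₀ q₁ C D) (x i) (z i) := by
      rw [mEst_sub_rEst_eq, mEst_eq, outcomeWeight, wCov_bern_val (isWeight_outcome h x z)]
      rfl
    rw [e2, e, linearTerm, mainTerm, ← Finset.sum_add_distrib, ← Finset.sum_sub_distrib, quadError]
    refine (Finset.abs_sum_le_sum_abs _ _).trans (Finset.sum_le_sum fun a _ => ?_)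
    rw [← mul_add, ← mul_sub, add_sub_add_left_eq_sub, ← mul_sub, abs_mul, abs_mul,
      abs_of_pos (one_div_pos.2 (hx' a)), abs_of_nonneg (sq_nonneg _)]
    refine mul_le_mul_of_nonneg_left (mul_le_mul_of_nonneg_left ?_ (sq_nonneg _))
      (one_div_pos.2 (hx' a)).le
    have hv : ∀ b, |cellVar (VStructure.tableY p q₀ q₁ C D) a b| ≤ 1 := fun b => by
      have := cellVar_mem h a b
      rw [abs_of_nonneg this.1]; exact this.2
    have d1 := abs_div_sub_div_le hγ hm.1 (g1 a) (hv true)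
      (abs_cellVar_sub_le hp0 hp1 hq₀ hq₁ h a true)
    have d0 := abs_div_sub_div_le hγ hm.2 (g0 a) (hv false)
      (abs_cellVar_sub_le hp0 hp1 hq₀ hq₁ h a false)
    rw [add_sub_cancel_left] at d1
    rw [sub_sub_cancel_left, abs_neg] at d0
    -- Each of the two values of `Z` contributes half of the weight in `quadError`.
    have eη : (|C| + |D|) / halfMargin p + |armDev x p z a| / halfMargin p ^ 2 =
      (|armDev x p z a| / (2 * halfMargin p ^ 2) + (|C| + |D|) / (2 * halfMargin p)) +
      (|armDev x p z a| / (2 * halfMargin p ^ 2) + (|C| + |D|) / (2 * halfMargin p)) := by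
      field_simp; ring
    rw [eη]
    refine le_trans (le_of_eq ?_) ((abs_add_le _ _).trans (add_le_add d1 d0))
    congr 1; ring

end Fixed

/-! ### Expansions for a fixed assignment of `X` -/

section FixedExpansion

variable {ι : Type*} [Fintype ι] [DecidableEq ι]

theorem isWeight_const {p : ℝ} (hp0 : 0 ≤ p) (hp1 : p ≤ 1) :
    IsWeight (bernWeight fun _ : ι => p) := isWeight_bern (fun _ => hp0) (fun _ => hp1)

theorem armExp_rEst {x : ι → Bool} (hx : ∀ a, 0 < armSize x a) {p q₀ q₁ C D : ℝ}
    (hp0 : 0 < p) (hp1 : p < 1)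
    (h : VStructure.ValidTable (VStructure.tableY p q₀ q₁ C D)) :
    armExp x p (VStructure.tableY p q₀ q₁ C D) (rEst x) = q₁ - q₀ := by
  simp only [armExp, wE_rEst hx h]
  rw [wE_add, wE_const (isWeight_const hp0.le hp1.le), wE_meanDevR, add_zero]

/-- The deviation of the conditional mean of `M` from its value when no cell is empty. -/
noncomputable def emptyCellError (p q₀ q₁ C D : ℝ) (x z : ι → Bool) : ℝ :=
  wE (outcomeWeight (VStructure.tableY p q₀ q₁ C D) x z) (mEst x z) - (q₁ - q₀) -
      meanDevM D x p z

theorem abs_armExp_mEst_sub_le {x : ι → Bool} (hx : ∀ a, 0 < armSize x a) {p q₀ q₁ C D : ℝ}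
    (hp0 : 0 < p) (hp1 : p < 1) (hq₀ : 0 ≤ q₀ ∧ q₀ ≤ 1) (hq₁ : 0 ≤ q₁ ∧ q₁ ≤ 1)
    (h : VStructure.ValidTable (VStructure.tableY p q₀ q₁ C D)) :
    |armExp x p (VStructure.tableY p q₀ q₁ C D) (mEst x) - (q₁ - q₀)| ≤
      4 * wE (bernWeight fun _ : ι => p) (badness x p) := by
  have hw := isWeight_const (ι := ι) hp0.le hp1.le
  have h1 := abs_wE_le hw (abs_wE_mEst_sub_le hx hp0 hp1 hq₀ hq₁ h)
  rw [wE_mul_left, wE_sub, wE_sub, wE_const hw] at h1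
  have h2 : wE (bernWeight fun _ : ι => p) (fun z => meanDevM D x p z) = 0 := wE_meanDevM D x p
  rwa [h2, sub_zero] at h1

theorem abs_armCov_rEst_add_le {x : ι → Bool} (hx : ∀ a, 1 ≤ armSize x a) {p q₀ q₁ C D : ℝ}
    (hp0 : 0 < p) (hp1 : p < 1) (hq₀ : 0 ≤ q₀ ∧ q₀ ≤ 1) (hq₁ : 0 ≤ q₁ ∧ q₁ ≤ 1)
    (h : VStructure.ValidTable (VStructure.tableY p q₀ q₁ C D)) :
    |armCov x p (VStructure.tableY p q₀ q₁ C D) (rEst x) (fun z y => mEst x z y - rEst x z y) +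
      VStructure.leadR p C D (armSize x true / (armSize x true + armSize x false)) /
        (armSize x true + armSize x false)| ≤
      16 * wE (bernWeight fun _ : ι => p) (badness x p) := by
  have hx' : ∀ a, 0 < armSize x a := fun a => zero_lt_one.trans_le (hx a)
  have hw := isWeight_const (ι := ι) hp0.le hp1.le
  obtain ⟨s1, s0, sD⟩ := abs_slopes_le h
  have b1 := abs_wE_le hw (fun z => abs_wCov_rEst_sub_le hx h hp0 hp1 z)
  rw [wE_sub, wE_mul_left] at b1
  have b1' : wE (bernWeight fun _ : ι => p)
    (fun z => linearTerm (VStructure.tableY p q₀ q₁ C D) x p z) = 0 := wE_linearTerm _ x p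
  rw [b1', sub_zero] at b1
  -- The mean of `R` given `Z` is exact and centred at `q₁ - q₀`, so the empty-cell error enters
  -- only through the second factor.
  have e2 : wCov (bernWeight fun _ : ι => p)
      (fun z => wE (outcomeWeight (VStructure.tableY p q₀ q₁ C D) x z) (rEst x z))
      (fun z => wE (outcomeWeight (VStructure.tableY p q₀ q₁ C D) x z)
        (fun y => mEst x z y - rEst x z y)) =
      wE (bernWeight fun _ : ι => p)
        (fun z => meanDevR C D x p z * (meanDevM D x p z - meanDevR C D x p z)) +
      wE (bernWeight fun _ : ι => p)
        (fun z => meanDevR C D x p z * emptyCellError p q₀ q₁ C D x z) := by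
    rw [← wCov_sub_const hw _ _ (q₁ - q₀) 0, wCov, ← wE_add]
    have z0 : wE (bernWeight fun _ : ι => p) (fun z =>
        wE (outcomeWeight (VStructure.tableY p q₀ q₁ C D) x z) (rEst x z) - (q₁ - q₀)) = 0 := by
      simp only [wE_rEst hx' h, add_sub_cancel_left]
      exact wE_meanDevR C D x p
    rw [z0, zero_mul, sub_zero]
    congr 1
    funext z
    rw [wE_sub, wE_rEst hx' h, emptyCellError]
    ring
  have b3 : |wE (bernWeight fun _ : ι => p)
      (fun z => meanDevR C D x p z * emptyCellError p q₀ q₁ C D x z)| ≤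
      8 * wE (bernWeight fun _ : ι => p) (badness x p) := by
    rw [← wE_mul_left]
    refine abs_wE_le hw fun z => ?_
    rw [abs_mul]
    have c1 := abs_meanDevR_le hx' hp0.le hp1.le s1 s0 z
    have c2 : |emptyCellError p q₀ q₁ C D x z| ≤ _ := abs_wE_mEst_sub_le hx' hp0 hp1 hq₀ hq₁ h z
    have := mul_le_mul c1 c2 (abs_nonneg _) zero_le_two
    linarith
  rw [armCov_eq, e2, wE_meanDevR_mul hx']
  rw [abs_le] at b1 b3 ⊢
  constructor <;> linarith [b1.1, b1.2, b3.1, b3.2]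

theorem abs_armCov_mEst_sub_le {x : ι → Bool} (hx : ∀ a, 1 ≤ armSize x a) {p q₀ q₁ C D : ℝ}
    (hp0 : 0 < p) (hp1 : p < 1) (hq₀ : 0 ≤ q₀ ∧ q₀ ≤ 1) (hq₁ : 0 ≤ q₁ ∧ q₁ ≤ 1)
    (h : VStructure.ValidTable (VStructure.tableY p q₀ q₁ C D)) :
    |armCov x p (VStructure.tableY p q₀ q₁ C D) (mEst x) (fun z y => mEst x z y - rEst x z y) -
      VStructure.leadM q₀ q₁ (armSize x true + armSize x false)
        (armSize x true / (armSize x true + armSize x false)) /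
          (armSize x true + armSize x false)| ≤
      (64 + 8 / halfMargin p) * wE (bernWeight fun _ : ι => p) (badness x p) +
        wE (bernWeight fun _ : ι => p) (quadError (|C| + |D|) x p) := by
  have hx' : ∀ a, 0 < armSize x a := fun a => zero_lt_one.trans_le (hx a)
  have hw := isWeight_const (ι := ι) hp0.le hp1.le
  obtain ⟨s1, s0, sD⟩ := abs_slopes_le h
  have b1 := abs_wE_le hw (fun z => abs_wCov_mEst_sub_le hx hp0 hp1 hq₀ hq₁ h z)
  rw [wE_sub, wE_add, wE_add, wE_mul_left] at b1
  have b1' : wE (bernWeight fun _ : ι => p)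
    (fun z => linearTerm (VStructure.tableY p q₀ q₁ C D) x p z) = 0 := wE_linearTerm _ x p
  have b1'' : wE (bernWeight fun _ : ι => p) (fun z => mainTerm q₀ q₁ x p z) = _ :=
    wE_mainTerm hx' q₀ q₁ hp0 hp1
  rw [b1', b1'', zero_add] at b1
  have hP : ∀ z, |meanDevM D x p z| ≤ 2 := abs_meanDevM_le hx' hp0.le hp1.le sD
  have hU : ∀ z, |meanDevR C D x p z| ≤ 2 := abs_meanDevR_le hx' hp0.le hp1.le s1 s0
  have he : ∀ z, |emptyCellError p q₀ q₁ C D x z| ≤ 4 * badness x p z := fun z =>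
    abs_wE_mEst_sub_le hx' hp0 hp1 hq₀ hq₁ h z
  have he4 : ∀ z, |emptyCellError p q₀ q₁ C D x z| ≤ 4 := fun z => by
    have b1 := abs_wE_le_const (isWeight_outcome h x z) (abs_mEst_le x z)
    have b2 := hP z
    rw [emptyCellError]
    rw [abs_le] at b1 b2 ⊢
    constructor <;> linarith [b1.1, b1.2, b2.1, b2.2, hq₀.1, hq₀.2, hq₁.1, hq₁.2]
  -- With `e` the empty-cell error, `(P + e)(P + e - U) = P(P - U) + e(2P + e - U)`; the product of
  -- the means is `(E e)²`, since `P` and `U` have mean zero. The last two terms cost 40 and 16,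
  -- which with the 8 of the conditional covariance make 64.
  have e2 : wCov (bernWeight fun _ : ι => p)
      (fun z => wE (outcomeWeight (VStructure.tableY p q₀ q₁ C D) x z) (mEst x z))
      (fun z => wE (outcomeWeight (VStructure.tableY p q₀ q₁ C D) x z)
        (fun y => mEst x z y - rEst x z y)) =
      wE (bernWeight fun _ : ι => p)
        (fun z => meanDevM D x p z * (meanDevM D x p z - meanDevR C D x p z)) +
      wE (bernWeight fun _ : ι => p) (fun z => emptyCellError p q₀ q₁ C D x z *
        (2 * meanDevM D x p z + emptyCellError p q₀ q₁ C D x z - meanDevR C D x p z)) -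
      wE (bernWeight fun _ : ι => p) (emptyCellError p q₀ q₁ C D x) *
        wE (bernWeight fun _ : ι => p) (emptyCellError p q₀ q₁ C D x) := by
    rw [← wCov_sub_const hw _ _ (q₁ - q₀) 0, wCov, ← wE_add]
    have z0 : wE (bernWeight fun _ : ι => p) (fun z =>
        wE (outcomeWeight (VStructure.tableY p q₀ q₁ C D) x z) (mEst x z) - (q₁ - q₀)) =
        wE (bernWeight fun _ : ι => p) (emptyCellError p q₀ q₁ C D x) := by
      have : (fun z => wE (outcomeWeight (VStructure.tableY p q₀ q₁ C D) x z) (mEst x z) -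
        (q₁ - q₀)) = fun z => emptyCellError p q₀ q₁ C D x z + meanDevM D x p z := by
        funext z; rw [emptyCellError]; ring
      have h2 : wE (bernWeight fun _ : ι => p) (fun z => meanDevM D x p z) = 0 := wE_meanDevM D x p
      rw [this, wE_add, h2, add_zero]
    have z1 : wE (bernWeight fun _ : ι => p) (fun z =>
        wE (outcomeWeight (VStructure.tableY p q₀ q₁ C D) x z)
          (fun y => mEst x z y - rEst x z y) - 0) =
        wE (bernWeight fun _ : ι => p) (emptyCellError p q₀ q₁ C D x) := by
      have : (fun z => wE (outcomeWeight (VStructure.tableY p q₀ q₁ C D) x z)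
          (fun y => mEst x z y - rEst x z y) - 0) = fun z =>
          emptyCellError p q₀ q₁ C D x z + meanDevM D x p z - meanDevR C D x p z := by
        funext z; rw [wE_sub, wE_rEst hx' h, emptyCellError]; ring
      have h2 : wE (bernWeight fun _ : ι => p) (fun z => meanDevM D x p z) = 0 := wE_meanDevM D x p
      have h3 : wE (bernWeight fun _ : ι => p) (fun z => meanDevR C D x p z) = 0 :=
        wE_meanDevR C D x p
      rw [this, wE_sub, wE_add, h2, h3, add_zero, sub_zero]
    rw [z0, z1]
    congr 2
    funext z
    rw [wE_sub, wE_rEst hx' h, emptyCellError]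
    ring
  have b3 : |wE (bernWeight fun _ : ι => p) (fun z => emptyCellError p q₀ q₁ C D x z *
        (2 * meanDevM D x p z + emptyCellError p q₀ q₁ C D x z - meanDevR C D x p z))| ≤
      40 * wE (bernWeight fun _ : ι => p) (badness x p) := by
    rw [← wE_mul_left]
    refine abs_wE_le hw fun z => ?_
    rw [abs_mul]
    have c1 : |2 * meanDevM D x p z + emptyCellError p q₀ q₁ C D x z - meanDevR C D x p z| ≤ 10 := by
      have a1 := abs_le.1 (hP z)
      have a2 := abs_le.1 (hU z)
      have a3 := abs_le.1 (he4 z)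
      rw [abs_le]; constructor <;> linarith [a1.1, a1.2, a2.1, a2.2, a3.1, a3.2]
    have := mul_le_mul (he z) c1 (abs_nonneg _)
      (mul_nonneg zero_le_four (badness_nonneg x p z))
    linarith
  have b4 : |wE (bernWeight fun _ : ι => p) (emptyCellError p q₀ q₁ C D x) *
      wE (bernWeight fun _ : ι => p) (emptyCellError p q₀ q₁ C D x)| ≤
      16 * wE (bernWeight fun _ : ι => p) (badness x p) := by
    rw [abs_mul]
    have c1 := abs_wE_le hw he
    rw [wE_mul_left] at c1
    have c2 := abs_wE_le_const hw he4
    have := mul_le_mul c1 c2 (abs_nonneg _)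
      (mul_nonneg zero_le_four (wE_nonneg hw (badness_nonneg x p)))
    have e : wE (bernWeight fun _ : ι => p) (fun b => badness x p b) =
      wE (bernWeight fun _ : ι => p) (badness x p) := rfl
    linarith
  rw [armCov_eq, e2, wE_meanDevM_mul hx']
  have e' : wE (bernWeight fun _ : ι => p) (fun b => badness x p b) =
      wE (bernWeight fun _ : ι => p) (badness x p) := rfl
  have e'' : wE (bernWeight fun _ : ι => p) (fun z => quadError (|C| + |D|) x p z) =
      wE (bernWeight fun _ : ι => p) (quadError (|C| + |D|) x p) := rfl
  rw [e', e''] at b1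
  rw [abs_le] at b1 b3 b4 ⊢
  constructor <;> linarith [b1.1, b1.2, b3.1, b3.2, b4.1, b4.2]

/-- The sixth power is what makes this `n^{-3}`: a fourth moment would only give `n^{-2}`, too large
for the required `N^{-5/2}`. -/
theorem wE_badness_le {x : ι → Bool} {p n : ℝ} (hn : 0 < n) (h : ∀ a, n ≤ armSize x a)
    (h1 : ∀ a, 1 ≤ armSize x a) (hp0 : 0 < p) (hp1 : p < 1) :
    wE (bernWeight fun _ : ι => p) (badness x p) ≤
      2 * momentConst 3 / halfMargin p ^ 6 / n ^ 3 := by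
  have hγ := halfMargin_pos hp0 hp1
  have e : badness x p = fun z => (1 / halfMargin p ^ 6) *
    (armDev x p z true ^ (2 * 3) + armDev x p z false ^ (2 * 3)) := by
    funext z; rw [badness]; ring
  rw [e, wE_mul_left, wE_add]
  have m1 := wE_armDev_moment_le hn (h true) (h1 true) hp0.le hp1.le 3
  have m0 := wE_armDev_moment_le hn (h false) (h1 false) hp0.le hp1.le 3
  calc _ ≤ 1 / halfMargin p ^ 6 * (momentConst 3 / n ^ 3 + momentConst 3 / n ^ 3) := by gcongr
    _ = _ := by ring

/-- The product `(t - uₐ)²|uₐ|` is of odd degree, while only even moments are at hand. The square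
`(2rS₂ - |uₐ|)² / r ≥ 0` trades it for degrees 4 and 2; with `r = √N` both pieces have expectation
of order `N^{-3/2}`. -/
theorem quadError_le {x : ι → Bool} {p n η r : ℝ} (hn : 0 < n) (h : ∀ a, n ≤ armSize x a)
    (hη : 0 ≤ η) (hr : 0 < r) (hp0 : 0 < p) (hp1 : p < 1) (z : ι → Bool) :
    quadError η x p z ≤
      (4 * η / halfMargin p + 1 / (r * halfMargin p ^ 2)) / n *
        (armDev x p z true ^ 2 + armDev x p z false ^ 2) +
      16 * r / halfMargin p ^ 2 / n * (armDev x p z true ^ 4 + armDev x p z false ^ 4) := by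
  have hγ := halfMargin_pos hp0 hp1
  have hx' : ∀ a, 0 < armSize x a := fun a => hn.trans_le (h a)
  set S2 := armDev x p z true ^ 2 + armDev x p z false ^ 2 with hS2
  set S4 := armDev x p z true ^ 4 + armDev x p z false ^ 4 with hS4
  have h20 : 0 ≤ S2 := by positivity
  have h40 : 0 ≤ S4 := by
    rw [hS4]; nlinarith [sq_nonneg (armDev x p z true ^ 2), sq_nonneg (armDev x p z false ^ 2)]
  have h24 : S2 ^ 2 ≤ 2 * S4 := by
    rw [hS2, hS4]; nlinarith [sq_nonneg (armDev x p z true ^ 2 - armDev x p z false ^ 2)]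
  have key : ∀ a, 1 / armSize x a * ((totalDev x p z - armDev x p z a) ^ 2 *
    (η / halfMargin p + |armDev x p z a| / halfMargin p ^ 2)) ≤
      1 / n * (2 * S2 * (η / halfMargin p) +
        (8 * r * S4 + armDev x p z a ^ 2 / r) / halfMargin p ^ 2) := by
    intro a
    have hT := sq_totalDev_sub_le hx' p z a
    have hA : 2 * S2 * |armDev x p z a| ≤ 8 * r * S4 + armDev x p z a ^ 2 / r := by
      have h1 : 0 ≤ (2 * r * S2 - |armDev x p z a|) ^ 2 / r := by positivity
      have h2 : (2 * r * S2 - |armDev x p z a|) ^ 2 / r =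
        4 * r * S2 ^ 2 - 4 * (S2 * |armDev x p z a|) + armDev x p z a ^ 2 / r := by
        rw [← sq_abs (armDev x p z a)]; field_simp; ring
      have h3 := mul_le_mul_of_nonneg_left h24 hr.le
      have h4 : 0 ≤ S2 * |armDev x p z a| := by positivity
      linarith
    have h1n : 1 / armSize x a ≤ 1 / n := one_div_le_one_div_of_le hn (h a)
    calc _ ≤ 1 / n * (2 * S2 * (η / halfMargin p + |armDev x p z a| / halfMargin p ^ 2)) := by
          have := (hx' a)
          gcongr
      _ = 1 / n * (2 * S2 * (η / halfMargin p) +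
          (2 * S2 * |armDev x p z a|) / halfMargin p ^ 2) := by ring
      _ ≤ _ := by gcongr
  rw [quadError, Fintype.sum_bool]
  refine (add_le_add (key true) (key false)).trans (le_of_eq ?_)
  rw [hS2]
  field_simp
  ring

theorem wE_quadError_le {x : ι → Bool} {p n η r : ℝ} (hn : 0 < n) (h : ∀ a, n ≤ armSize x a)
    (h1 : ∀ a, 1 ≤ armSize x a)
    (hη : 0 ≤ η) (hr : 0 < r) (hp0 : 0 < p) (hp1 : p < 1) :
    wE (bernWeight fun _ : ι => p) (quadError η x p) ≤
      (4 * η / halfMargin p + 1 / (r * halfMargin p ^ 2)) / n * (2 * momentConst 1 / n) +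
      16 * r / halfMargin p ^ 2 / n * (2 * momentConst 2 / n ^ 2) := by
  have hγ := halfMargin_pos hp0 hp1
  have hw := isWeight_const (ι := ι) hp0.le hp1.le
  refine (wE_mono hw (quadError_le hn h hη hr hp0 hp1)).trans ?_
  rw [wE_add, wE_mul_left, wE_mul_left, wE_add, wE_add]
  have m1 := wE_armDev_moment_le hn (h true) (h1 true) hp0.le hp1.le 1
  have m0 := wE_armDev_moment_le hn (h false) (h1 false) hp0.le hp1.le 1
  have m1' := wE_armDev_moment_le hn (h true) (h1 true) hp0.le hp1.le 2
  have m0' := wE_armDev_moment_le hn (h false) (h1 false) hp0.le hp1.le 2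
  rw [pow_one] at m1 m0
  have e1 : 2 * momentConst 1 / n = momentConst 1 / n + momentConst 1 / n := by ring
  have e2 : 2 * momentConst 2 / n ^ 2 = momentConst 2 / n ^ 2 + momentConst 2 / n ^ 2 := by ring
  rw [e1, e2]
  gcongr

/-- The constant of the expansions for a fixed assignment of `X`. -/
noncomputable def fixedConst (p ε K : ℝ) : ℝ :=
  (64 + 8 / halfMargin p) * (2 * momentConst 3 / halfMargin p ^ 6 / ε ^ 3) +
    ((8 * K / halfMargin p + 1 / halfMargin p ^ 2) / ε * (2 * momentConst 1 / ε) +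
      16 / halfMargin p ^ 2 / ε * (2 * momentConst 2 / ε ^ 2))

theorem sixteen_mul_le_fixedConst {p ε K : ℝ} (hp0 : 0 < p) (hp1 : p < 1) (hε : 0 < ε)
    (hK : 0 ≤ K) :
    16 * (2 * momentConst 3 / halfMargin p ^ 6 / ε ^ 3) ≤ fixedConst p ε K := by
  have hγ := halfMargin_pos hp0 hp1
  have h1 := momentConst_pos 1
  have h2 := momentConst_pos 2
  have h3 := momentConst_pos 3
  have a : 0 ≤ ((8 * K / halfMargin p + 1 / halfMargin p ^ 2) / ε * (2 * momentConst 1 / ε) +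
      16 / halfMargin p ^ 2 / ε * (2 * momentConst 2 / ε ^ 2)) := by positivity
  have b : 16 * (2 * momentConst 3 / halfMargin p ^ 6 / ε ^ 3) ≤
      (64 + 8 / halfMargin p) * (2 * momentConst 3 / halfMargin p ^ 6 / ε ^ 3) := by
    gcongr
    have : 0 ≤ 8 / halfMargin p := by positivity
    linarith
  unfold fixedConst
  linarith

theorem fixedConst_nonneg {p ε K : ℝ} (hp0 : 0 < p) (hp1 : p < 1) (hε : 0 < ε)
    (hK : 0 ≤ K) : 0 ≤ fixedConst p ε K := by
  have hγ := halfMargin_pos hp0 hp1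
  have h3 := momentConst_pos 3
  exact le_trans (by positivity) (sixteen_mul_le_fixedConst hp0 hp1 hε hK)

/-- The expansions for a fixed assignment of `X`, with `r = √N`. -/
theorem fixed_expansions {x : ι → Bool} {p q₀ q₁ C D ε K N r : ℝ}
    (hp0 : 0 < p) (hp1 : p < 1) (hq₀ : 0 ≤ q₀ ∧ q₀ ≤ 1) (hq₁ : 0 ≤ q₁ ∧ q₁ ≤ 1)
    (h : VStructure.ValidTable (VStructure.tableY p q₀ q₁ C D))
    (hε : 0 < ε) (hr : 1 ≤ r) (hN : N = r ^ 2) (hs : armSize x true + armSize x false = N)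
    (hx : ∀ a, ε * N ≤ armSize x a) (hx1 : ∀ a, 1 ≤ armSize x a)
    (hC : |C| ≤ K / r) (hD : |D| ≤ K / r) :
    |N * armCov x p (VStructure.tableY p q₀ q₁ C D) (rEst x)
        (fun z y => mEst x z y - rEst x z y) + VStructure.leadR p C D (armSize x true / N)| ≤
      fixedConst p ε K / r ^ 3 ∧
    |N * armCov x p (VStructure.tableY p q₀ q₁ C D) (mEst x)
        (fun z y => mEst x z y - rEst x z y) - VStructure.leadM q₀ q₁ N (armSize x true / N)| ≤
      fixedConst p ε K / r ^ 3 ∧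
    |armExp x p (VStructure.tableY p q₀ q₁ C D) (mEst x) - (q₁ - q₀)| ≤
      fixedConst p ε K / r ^ 5 := by
  have hγ := halfMargin_pos hp0 hp1
  have hr0 : 0 < r := by linarith
  have hN0 : 0 < N := by rw [hN]; positivity
  have hK : 0 ≤ K := by
    have := (abs_nonneg C).trans hC
    have := mul_nonneg this hr0.le
    rwa [div_mul_cancel₀ _ hr0.ne'] at this
  have hn : 0 < ε * N := by positivity
  have hx' : ∀ a, 0 < armSize x a := fun a => zero_lt_one.trans_le (hx1 a)
  have k1 := abs_armCov_rEst_add_le hx1 hp0 hp1 hq₀ hq₁ h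
  have k2 := abs_armCov_mEst_sub_le hx1 hp0 hp1 hq₀ hq₁ h
  have k3 := abs_armExp_mEst_sub_le hx' hp0 hp1 hq₀ hq₁ h
  rw [hs] at k1 k2
  have bd := wE_badness_le hn hx hx1 hp0 hp1
  have bd0 := wE_nonneg (isWeight_const (ι := ι) hp0.le hp1.le) (badness_nonneg x p)
  have qd := wE_quadError_le hn hx hx1 (η := |C| + |D|) (by positivity) hr0 hp0 hp1
  have m1 := momentConst_pos 1
  have m2 := momentConst_pos 2
  have m3 := momentConst_pos 3
  have hc := sixteen_mul_le_fixedConst hp0 hp1 hε hK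
  set δ := wE (bernWeight fun _ : ι => p) (badness x p)
  set c3 := 2 * momentConst 3 / halfMargin p ^ 6 / ε ^ 3 with hc3
  have hc30 : 0 ≤ c3 := by positivity
  -- The bound is of order `r⁻⁶`; it is weakened to the order of the quadratic error.
  have bd' : δ ≤ c3 / r ^ 5 := by
    refine bd.trans ?_
    have : 2 * momentConst 3 / halfMargin p ^ 6 / (ε * N) ^ 3 = c3 / r ^ 6 := by
      rw [hc3, hN]; field_simp
    rw [this]
    gcongr
    norm_num
  have qd' : wE (bernWeight fun _ : ι => p) (quadError (|C| + |D|) x p) ≤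
      ((8 * K / halfMargin p + 1 / halfMargin p ^ 2) / ε * (2 * momentConst 1 / ε) +
      16 / halfMargin p ^ 2 / ε * (2 * momentConst 2 / ε ^ 2)) / r ^ 5 := by
    refine qd.trans ?_
    have : |C| + |D| ≤ 2 * K / r := by
      calc |C| + |D| ≤ K / r + K / r := add_le_add hC hD
        _ = _ := by ring
    calc _ ≤ (4 * (2 * K / r) / halfMargin p + 1 / (r * halfMargin p ^ 2)) / (ε * N) *
          (2 * momentConst 1 / (ε * N)) +
          16 * r / halfMargin p ^ 2 / (ε * N) * (2 * momentConst 2 / (ε * N) ^ 2) := by gcongr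
      _ = _ := by rw [hN]; field_simp; ring
  have scale : ∀ u v c : ℝ, |u - v / N| ≤ c / r ^ 5 → |N * u - v| ≤ c / r ^ 3 := by
    intro u v c hu
    have e : N * u - v = N * (u - v / N) := by field_simp
    rw [e, abs_mul, abs_of_pos hN0]
    calc N * |u - v / N| ≤ N * (c / r ^ 5) := by gcongr
      _ = c / r ^ 3 := by rw [hN]; field_simp
  refine ⟨?_, ?_, ?_⟩
  · have := scale (armCov x p (VStructure.tableY p q₀ q₁ C D) (rEst x)
        (fun z y => mEst x z y - rEst x z y)) (-VStructure.leadR p C D (armSize x true / N))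
        (fixedConst p ε K) ?_
    · rwa [sub_neg_eq_add] at this
    · rw [neg_div, sub_neg_eq_add]
      refine k1.trans ?_
      calc 16 * δ ≤ 16 * (c3 / r ^ 5) := by gcongr
        _ = (16 * c3) / r ^ 5 := by ring
        _ ≤ _ := by gcongr
  · refine scale _ _ _ (k2.trans ?_)
    calc _ ≤ (64 + 8 / halfMargin p) * (c3 / r ^ 5) + _ := add_le_add (by gcongr) qd'
      _ = _ := by rw [fixedConst]; ring
  · refine k3.trans ?_
    calc 4 * δ ≤ 16 * (c3 / r ^ 5) := by
          have : 4 * δ ≤ 16 * δ := by linarith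
          linarith
      _ = (16 * c3) / r ^ 5 := by ring
      _ ≤ _ := by gcongr

end FixedExpansion

/-! ### Regularity and size of the leading terms -/

/-- Being quadratic in `C, D`, the leading term has a Lipschitz constant of order `s²`, which is
`O(1/N)` in the scaling limit. -/
theorem leadR_lipschitz {p ξ q C D s ε : ℝ} (hp0 : 0 ≤ p) (hp1 : p ≤ 1) (hε : 0 < ε)
    (hq : ε ≤ q) (hq' : ε ≤ 1 - q) (hξ : ε ≤ ξ) (hξ' : ε ≤ 1 - ξ) (hC : |C| ≤ s) (hD : |D| ≤ s) :
    |VStructure.leadR p C D ξ - VStructure.leadR p C D q| ≤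
      (12 / ε ^ 2 + 9 / ε ^ 4) * s ^ 2 * |ξ - q| := by
  have hs : 0 ≤ s := (abs_nonneg C).trans hC
  have bnd : ∀ t : ℝ, 0 ≤ t → t ≤ 1 → |2 * C + (2 * t - 1) * D| ≤ 3 * s := by
    intro t h0 h1
    have h2 : |(2 * t - 1) * D| ≤ s := by
      rw [abs_mul]
      have : |2 * t - 1| ≤ 1 := by rw [abs_le]; constructor <;> linarith
      calc _ ≤ 1 * s := by gcongr
        _ = s := one_mul s
    have h3 : |2 * C| ≤ 2 * s := by rw [abs_mul, abs_two]; linarith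
    linarith [abs_add_le (2 * C) ((2 * t - 1) * D)]
  have bξ := bnd ξ (by linarith) (by linarith)
  have bq := bnd q (by linarith) (by linarith)
  have p1 : ε ^ 2 ≤ ξ * (1 - ξ) := by rw [sq]; gcongr; linarith
  have p2 : ε ^ 2 ≤ q * (1 - q) := by rw [sq]; gcongr; linarith
  have e2 : 0 < ε ^ 2 := by positivity
  have p1' : 0 < ξ * (1 - ξ) := e2.trans_le p1
  have p2' : 0 < q * (1 - q) := e2.trans_le p2
  have ξ0 : ξ ≠ 0 := by linarith
  have ξ1 : 1 - ξ ≠ 0 := by linarith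
  have q0 : q ≠ 0 := by linarith
  have q1 : 1 - q ≠ 0 := by linarith
  -- The difference of squares is factored, and the difference of the reciprocals of `ξ(1 - ξ)` and
  -- `q(1 - q)` is treated separately.
  have e : VStructure.leadR p C D ξ - VStructure.leadR p C D q =
      p * (1 - p) * ((ξ - q) * (2 * D) *
        ((2 * C + (2 * ξ - 1) * D) + (2 * C + (2 * q - 1) * D)) / (ξ * (1 - ξ)) +
        (2 * C + (2 * q - 1) * D) ^ 2 * ((ξ - q) * (ξ + q - 1)) /
          ((ξ * (1 - ξ)) * (q * (1 - q)))) := by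
    unfold VStructure.leadR
    field_simp; ring
  rw [e, abs_mul]
  have hσ : |p * (1 - p)| ≤ 1 := by rw [abs_le]; constructor <;> nlinarith
  refine (mul_le_of_le_one_left (abs_nonneg _) hσ).trans ?_
  refine (abs_add_le _ _).trans ?_
  have t1 : |(ξ - q) * (2 * D) * ((2 * C + (2 * ξ - 1) * D) + (2 * C + (2 * q - 1) * D)) /
      (ξ * (1 - ξ))| ≤ |ξ - q| * (2 * s) * (6 * s) / ε ^ 2 := by
    rw [abs_div, abs_of_pos p1', abs_mul, abs_mul]
    have a1 : |2 * D| ≤ 2 * s := by rw [abs_mul, abs_two]; linarith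
    have a2 : |(2 * C + (2 * ξ - 1) * D) + (2 * C + (2 * q - 1) * D)| ≤ 6 * s := by
      linarith [abs_add_le (2 * C + (2 * ξ - 1) * D) (2 * C + (2 * q - 1) * D)]
    gcongr
  have t2 : |(2 * C + (2 * q - 1) * D) ^ 2 * ((ξ - q) * (ξ + q - 1)) /
      ((ξ * (1 - ξ)) * (q * (1 - q)))| ≤ (3 * s) ^ 2 * (|ξ - q| * 1) / (ε ^ 2 * ε ^ 2) := by
    rw [abs_div, abs_of_pos (mul_pos p1' p2'), abs_mul, abs_mul, abs_pow]
    have a2 : |ξ + q - 1| ≤ 1 := by rw [abs_le]; constructor <;> linarith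
    gcongr
  refine (add_le_add t1 t2).trans (le_of_eq ?_)
  field_simp; ring

theorem leadM_lipschitz {ξ q q₀ q₁ N ε : ℝ} (hq₀ : 0 ≤ q₀ ∧ q₀ ≤ 1) (hq₁ : 0 ≤ q₁ ∧ q₁ ≤ 1)
    (hN : 0 < N) (hε : 0 < ε)
    (hq : ε ≤ q) (hq' : ε ≤ 1 - q) (hξ : ε ≤ ξ) (hξ' : ε ≤ 1 - ξ) :
    |VStructure.leadM q₀ q₁ N ξ - VStructure.leadM q₀ q₁ N q| ≤ 4 / ε ^ 4 / N * |ξ - q| := by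
  have key : ∀ v u t : ℝ, 0 ≤ v → v ≤ 1 → ε ≤ u → ε ≤ 1 - u → ε ≤ t → ε ≤ 1 - t →
      |v * (1 - u) / (N * u ^ 2) - v * (1 - t) / (N * t ^ 2)| ≤ 2 / ε ^ 4 / N * |u - t| := by
    intro v u t v0 v1 u0 u1 t0 t1
    have hu : 0 < u := by linarith
    have ht : 0 < t := by linarith
    have e : v * (1 - u) / (N * u ^ 2) - v * (1 - t) / (N * t ^ 2) =
        v * ((t - u) * (t + u - t * u)) / (N * (u ^ 2 * t ^ 2)) := by field_simp; ring
    have a1 : |t + u - t * u| ≤ 2 := by rw [abs_le]; constructor <;> nlinarith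
    rw [e, abs_div, abs_mul, abs_mul, abs_of_pos (by positivity : 0 < N * (u ^ 2 * t ^ 2)),
      abs_of_nonneg v0, abs_sub_comm]
    calc _ ≤ 1 * (|u - t| * 2) / (N * (ε ^ 2 * ε ^ 2)) := by gcongr
      _ = _ := by field_simp
  have hv : ∀ q : ℝ, 0 ≤ q ∧ q ≤ 1 → 0 ≤ q * (1 - q) ∧ q * (1 - q) ≤ 1 := fun q h => by
    constructor <;> nlinarith [h.1, h.2]
  have k1 := key _ ξ q (hv q₁ hq₁).1 (hv q₁ hq₁).2 hξ hξ' hq hq'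
  -- The second summand of `leadM` is the first one with the arms exchanged.
  have k0 := key _ (1 - ξ) (1 - q) (hv q₀ hq₀).1 (hv q₀ hq₀).2 hξ' (by linarith) hq' (by linarith)
  have e1 : 1 - ξ - (1 - q) = -(ξ - q) := by ring
  rw [e1, abs_neg, sub_sub_cancel, sub_sub_cancel] at k0
  have := (abs_add_le _ _).trans (add_le_add k1 k0)
  have e2 : 4 / ε ^ 4 / N * |ξ - q| = 2 / ε ^ 4 / N * |ξ - q| + 2 / ε ^ 4 / N * |ξ - q| := by ring
  rw [e2]
  refine le_trans (le_of_eq ?_) this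
  unfold VStructure.leadM
  congr 1; ring

theorem abs_leadR_le {p q C D s ε : ℝ} (hp0 : 0 ≤ p) (hp1 : p ≤ 1) (hε : 0 < ε)
    (hq : ε ≤ q) (hq' : ε ≤ 1 - q) (hC : |C| ≤ s) (hD : |D| ≤ s) :
    |VStructure.leadR p C D q| ≤ 9 / ε ^ 2 * s ^ 2 := by
  have hs : 0 ≤ s := (abs_nonneg C).trans hC
  have h2 : |(2 * q - 1) * D| ≤ s := by
    rw [abs_mul]
    have : |2 * q - 1| ≤ 1 := by rw [abs_le]; constructor <;> linarith
    calc _ ≤ 1 * s := by gcongr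
      _ = s := one_mul s
  have h3 : |2 * C| ≤ 2 * s := by rw [abs_mul, abs_two]; linarith
  have bq : |2 * C + (2 * q - 1) * D| ≤ 3 * s := by
    linarith [abs_add_le (2 * C) ((2 * q - 1) * D)]
  have p2 : ε ^ 2 ≤ q * (1 - q) := by rw [sq]; gcongr; linarith
  have hσ : |p * (1 - p)| ≤ 1 := by rw [abs_le]; constructor <;> nlinarith
  have : 0 < q * (1 - q) := lt_of_lt_of_le (by positivity) p2
  rw [VStructure.leadR, abs_mul, abs_div, abs_pow, abs_of_pos this]
  calc _ ≤ 1 / ε ^ 2 * (3 * s) ^ 2 := by gcongr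
    _ = _ := by ring

theorem abs_leadM_le {q q₀ q₁ N ε : ℝ} (hq₀ : 0 ≤ q₀ ∧ q₀ ≤ 1) (hq₁ : 0 ≤ q₁ ∧ q₁ ≤ 1)
    (hN : 0 < N) (hε : 0 < ε) (hq : ε ≤ q) (hq' : ε ≤ 1 - q) :
    |VStructure.leadM q₀ q₁ N q| ≤ 2 / ε ^ 2 / N := by
  have hv : ∀ q : ℝ, 0 ≤ q ∧ q ≤ 1 → 0 ≤ q * (1 - q) ∧ q * (1 - q) ≤ 1 := fun q h => by
    constructor <;> nlinarith [h.1, h.2]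
  have v1 := hv q₁ hq₁
  have v0 := hv q₀ hq₀
  have hq0 : 0 < q := by linarith
  have hq1 : 0 < 1 - q := by linarith
  have := v1.1
  have := v0.1
  rw [VStructure.leadM, abs_of_nonneg (by positivity)]
  calc _ ≤ 1 * 1 / (N * ε ^ 2) + 1 * 1 / (N * ε ^ 2) := by
        gcongr
        · exact v1.2
        · linarith
        · exact v0.2
        · linarith
    _ = _ := by field_simp; norm_num

theorem abs_wCov_le_mul {Ω : Type*} [Fintype Ω] {w : Ω → ℝ} (hw : IsWeight w) {f g φ : Ω → ℝ} {d : ℝ}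
    (hf : ∀ b, |f b| ≤ φ b) (hg : ∀ b, |g b| ≤ d) : |wCov w f g| ≤ 2 * d * wE w φ := by
  have h1 : |wE w (fun b => f b * g b)| ≤ d * wE w φ := by
    rw [← wE_mul_left]
    refine abs_wE_le hw fun b => ?_
    rw [abs_mul, mul_comm]
    exact mul_le_mul (hg b) (hf b) (abs_nonneg _) ((abs_nonneg _).trans (hg b))
  have h2 : |wE w f * wE w g| ≤ d * wE w φ := by
    have a := abs_wE_le hw hf
    rw [abs_mul, mul_comm]
    have b := abs_wE_le_const hw hg
    exact mul_le_mul b a (abs_nonneg _) ((abs_nonneg _).trans b)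
  have := abs_sub (wE w (fun b => f b * g b)) (wE w f * wE w g)
  unfold wCov
  linarith

/-! ### Expansions for random `X` -/

section Random

variable {ι : Type*} [Fintype ι] [DecidableEq ι]

theorem one_le_armSize {x : ι → Bool} {a : Bool} (h : 0 < armSize x a) : 1 ≤ armSize x a := by
  have e : armSize x a = ((Finset.univ.filter fun i => x i = a).card : ℝ) := by
    rw [armSize, Finset.card_filter, Nat.cast_sum]
    exact Finset.sum_congr rfl fun i _ => by split_ifs <;> simp
  rw [e] at h ⊢
  exact_mod_cast h

theorem abs_armExp_le {pY : Bool → Bool → ℝ} (h : VStructure.ValidTable pY) (x : ι → Bool) {p c : ℝ}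
    (hp0 : 0 ≤ p) (hp1 : p ≤ 1) {f : (ι → Bool) → (ι → Bool) → ℝ} (hf : ∀ z y, |f z y| ≤ c) :
    |armExp x p pY f| ≤ c :=
  abs_wE_le_const (isWeight_const hp0 hp1) fun z => abs_wE_le_const (isWeight_outcome h x z) (hf z)

theorem abs_armCov_le {pY : Bool → Bool → ℝ} (h : VStructure.ValidTable pY) (x : ι → Bool) {p c d : ℝ}
    (hp0 : 0 ≤ p) (hp1 : p ≤ 1) {f g : (ι → Bool) → (ι → Bool) → ℝ} (hf : ∀ z y, |f z y| ≤ c)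
    (hg : ∀ z y, |g z y| ≤ d) (hc : 0 ≤ c) : |armCov x p pY f g| ≤ 2 * (c * d) := by
  have h1 := abs_armExp_le h x hp0 hp1 (f := fun z y => f z y * g z y) (c := c * d) fun z y => by
    rw [abs_mul]; exact mul_le_mul (hf z y) (hg z y) (abs_nonneg _) hc
  have h2 : |armExp x p pY f * armExp x p pY g| ≤ c * d := by
    rw [abs_mul]
    exact mul_le_mul (abs_armExp_le h x hp0 hp1 hf) (abs_armExp_le h x hp0 hp1 hg)
      (abs_nonneg _) hc
  have := abs_sub (armExp x p pY (fun z y => f z y * g z y)) (armExp x p pY f * armExp x p pY g)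
  unfold armCov
  linarith

/-- The deviation of the fraction of units with `X = 1` from `q`. -/
noncomputable def sizeDev (q : ℝ) (x : ι → Bool) : ℝ :=
  ∑ i, (1 / (Fintype.card ι : ℝ)) * (bval (x i) - q)

theorem armSize_true_div {N : ℝ} (hN : 0 < N) (hc : (Fintype.card ι : ℝ) = N) (q : ℝ)
    (x : ι → Bool) : armSize x true / N = q + sizeDev q x := by
  have e : armSize x true = ∑ i, bval (x i) :=
    Finset.sum_congr rfl fun i _ => by cases x i <;> simp
  rw [e, sizeDev, ← Finset.mul_sum, Finset.sum_sub_distrib, hc]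
  simp [hc]
  field_simp; ring

theorem wE_sizeDev_moment_le {N q : ℝ} (hN : 1 ≤ N) (hc : (Fintype.card ι : ℝ) = N)
    (hq0 : 0 ≤ q) (hq1 : q ≤ 1) (k : ℕ) :
    wE (bernWeight fun _ : ι => q) (fun x => sizeDev q x ^ (2 * k)) ≤ momentConst k / N ^ k := by
  have hN0 : 0 < N := by linarith
  refine wE_bern_moment_le (fun _ => hq0) (fun _ => hq1) hN0 (fun i => ?_) (le_of_eq ?_) k
  · rw [hc, abs_of_pos (by positivity)]
    apply one_div_le_one_div_of_le (Real.sqrt_pos.2 hN0)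
    rw [Real.sqrt_le_left hN0.le]
    nlinarith
  · simp [hc]; field_simp

/-- Averages over `X` an expansion valid for balanced arms. Elsewhere the crude bound `c₂ r²`, of
the size of the factor `N`, is beaten by a sixth moment of order `r⁻⁶`. -/
theorem abs_wE_sub_le_of_sizeDev {N r q c₁ c₂ c₃ L : ℝ} (hr : 1 ≤ r) (hN : N = r ^ 2)
    (hc : (Fintype.card ι : ℝ) = N) (hq0 : 0 < q) (hq1 : q < 1) (h1 : 0 ≤ c₁) (h2 : 0 ≤ c₂)
    (h3 : 0 ≤ c₃)
    {F : (ι → Bool) → ℝ} (hF : ∀ x, |sizeDev q x| ≤ halfMargin q →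
      |F x - L| ≤ c₁ / r ^ 3 + c₃ / r ^ 2 * |sizeDev q x|) (hF' : ∀ x, |F x - L| ≤ c₂ * r ^ 2) :
    |wE (bernWeight fun _ : ι => q) F - L| ≤
      (c₂ * momentConst 3 / halfMargin q ^ 6 + c₁ + c₃ * (momentConst 1 + 1)) / r ^ 3 := by
  have hr0 : 0 < r := by linarith
  have hw := isWeight_const (ι := ι) hq0.le hq1.le
  have hγ := halfMargin_pos hq0 hq1
  have hN1 : 1 ≤ N := by rw [hN]; nlinarith
  have pt : ∀ x, |F x - L| ≤ c₂ * r ^ 2 / halfMargin q ^ 6 * sizeDev q x ^ (2 * 3) +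
      (c₃ / r * sizeDev q x ^ (2 * 1) + (c₁ / r ^ 3 + c₃ / r ^ 3)) := by
    intro x
    have hd6 : 0 ≤ sizeDev q x ^ (2 * 3) := Even.pow_nonneg ⟨3, rfl⟩ _
    have hd2 : 0 ≤ sizeDev q x ^ (2 * 1) := Even.pow_nonneg ⟨1, rfl⟩ _
    have hrest : 0 ≤ c₃ / r * sizeDev q x ^ (2 * 1) + (c₁ / r ^ 3 + c₃ / r ^ 3) := by positivity
    by_cases hx : |sizeDev q x| ≤ halfMargin q
    · have k := hF x hx
      -- Only even moments are available; both terms on the right have expectation of order `1/r`.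
      have amgm : |sizeDev q x| ≤ r * sizeDev q x ^ 2 + 1 / r := by
        have a : 0 ≤ (r * |sizeDev q x| - 1) ^ 2 / r := by positivity
        have b : (r * |sizeDev q x| - 1) ^ 2 / r =
          r * |sizeDev q x| ^ 2 - 2 * |sizeDev q x| + 1 / r := by field_simp; ring
        rw [b, sq_abs] at a
        linarith [abs_nonneg (sizeDev q x)]
      have k2 : c₃ / r ^ 2 * |sizeDev q x| ≤ c₃ / r ^ 2 * (r * sizeDev q x ^ 2 + 1 / r) := by gcongr
      have k3 : c₃ / r ^ 2 * (r * sizeDev q x ^ 2 + 1 / r) =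
        c₃ / r * sizeDev q x ^ (2 * 1) + c₃ / r ^ 3 := by field_simp
      have k4 : 0 ≤ c₂ * r ^ 2 / halfMargin q ^ 6 * sizeDev q x ^ (2 * 3) := by positivity
      linarith
    · have h6 : halfMargin q ^ 6 ≤ sizeDev q x ^ (2 * 3) := by
        have := pow_le_pow_left₀ hγ.le (not_le.1 hx).le 6
        rwa [Even.pow_abs ⟨3, rfl⟩] at this
      have : c₂ * r ^ 2 ≤ c₂ * r ^ 2 / halfMargin q ^ 6 * sizeDev q x ^ (2 * 3) := by
        rw [div_mul_eq_mul_div, le_div_iff₀ (by positivity)]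
        gcongr
      linarith [hF' x]
  have m3 := wE_sizeDev_moment_le hN1 hc hq0.le hq1.le 3
  have m1 := wE_sizeDev_moment_le hN1 hc hq0.le hq1.le 1
  have b := abs_wE_le hw pt
  rw [wE_sub, wE_const hw, wE_add, wE_add, wE_const hw, wE_mul_left, wE_mul_left] at b
  refine b.trans ?_
  have p1 := momentConst_pos 1
  have p3 := momentConst_pos 3
  calc _ ≤ c₂ * r ^ 2 / halfMargin q ^ 6 * (momentConst 3 / N ^ 3) +
        (c₃ / r * (momentConst 1 / N ^ 1) + (c₁ / r ^ 3 + c₃ / r ^ 3)) := by gcongr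
    _ = c₂ * momentConst 3 / halfMargin q ^ 6 / r ^ 4 +
        (c₁ + c₃ * (momentConst 1 + 1)) / r ^ 3 := by rw [hN]; field_simp; ring
    _ ≤ c₂ * momentConst 3 / halfMargin q ^ 6 / r ^ 3 +
        (c₁ + c₃ * (momentConst 1 + 1)) / r ^ 3 := by
      gcongr
      norm_num
    _ = _ := by ring

/-- The expectation of a function of `X`, `Z` and `Y` when `X` is random. -/
def randExp (q p : ℝ) (pY : Bool → Bool → ℝ) (f : (ι → Bool) → (ι → Bool) → (ι → Bool) → ℝ) : ℝ :=
  wE (bernWeight fun _ : ι => q) fun x => armExp x p pY (f x)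

/-- The covariance of two functions of `X`, `Z` and `Y` when `X` is random. -/
def randCov (q p : ℝ) (pY : Bool → Bool → ℝ)
    (f g : (ι → Bool) → (ι → Bool) → (ι → Bool) → ℝ) : ℝ :=
  randExp q p pY (fun x z y => f x z y * g x z y) - randExp q p pY f * randExp q p pY g

/-- The law of total covariance, now conditioning on `X`. -/
theorem randCov_eq (q p : ℝ) (pY : Bool → Bool → ℝ)
    (f g : (ι → Bool) → (ι → Bool) → (ι → Bool) → ℝ) : randCov q p pY f g =
      wE (bernWeight fun _ : ι => q) (fun x => armCov x p pY (f x) (g x)) +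
      wCov (bernWeight fun _ : ι => q) (fun x => armExp x p pY (f x))
        (fun x => armExp x p pY (g x)) := by
  simp only [randCov, randExp, armCov, wCov, wE_sub]; ring

theorem arms_of_sizeDev {N q : ℝ} (hN : 0 < N) (hc : (Fintype.card ι : ℝ) = N) (hq0 : 0 < q)
    (hq1 : q < 1) {x : ι → Bool} (hx : |sizeDev q x| ≤ halfMargin q) :
    halfMargin q ≤ armSize x true / N ∧ halfMargin q ≤ 1 - armSize x true / N ∧
      armSize x true + armSize x false = N ∧ (∀ a, halfMargin q * N ≤ armSize x a) ∧
      ∀ a, 1 ≤ armSize x a := by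
  have hγ := halfMargin_pos hq0 hq1
  have hm := two_halfMargin_le q
  have hd := abs_le.1 hx
  have e := armSize_true_div hN hc q x
  have hs : armSize x true + armSize x false = N := by
    rw [← hc, ← sum_armSize x, Fintype.sum_bool]
  have h1 : halfMargin q ≤ armSize x true / N := by rw [e]; linarith [hd.1]
  have h0 : halfMargin q ≤ 1 - armSize x true / N := by rw [e]; linarith [hd.2]
  have ha : ∀ a, halfMargin q * N ≤ armSize x a := by
    intro a
    cases a
    · have : 1 - armSize x true / N = armSize x false / N := by
        rw [← hs]; rw [← hs] at hN; field_simp; ring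
      rwa [this, le_div_iff₀ hN] at h0
    · rwa [le_div_iff₀ hN] at h1
  exact ⟨h1, h0, hs, ha, fun a => one_le_armSize ((mul_pos hγ hN).trans_le (ha a))⟩

/-- The expansions for random `X`, with `r = √N`. -/
theorem random_expansions {p q q₀ q₁ K : ℝ} (hp0 : 0 < p) (hp1 : p < 1) (hq0 : 0 < q) (hq1 : q < 1)
    (hq₀ : 0 ≤ q₀ ∧ q₀ ≤ 1) (hq₁ : 0 ≤ q₁ ∧ q₁ ≤ 1) (hK : 0 ≤ K) :
    ∃ B : ℝ, ∀ {ι : Type} [Fintype ι] [DecidableEq ι] {C D N r : ℝ},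
      VStructure.ValidTable (VStructure.tableY p q₀ q₁ C D) → 1 ≤ r → N = r ^ 2 →
      (Fintype.card ι : ℝ) = N → |C| ≤ K / r → |D| ≤ K / r →
      |N * randCov (ι := ι) q p (VStructure.tableY p q₀ q₁ C D) rEst
        (fun x z y => mEst x z y - rEst x z y) + VStructure.leadR p C D q| ≤ B / r ^ 3 ∧
      |N * randCov (ι := ι) q p (VStructure.tableY p q₀ q₁ C D) mEst
        (fun x z y => mEst x z y - rEst x z y) - VStructure.leadM q₀ q₁ N q| ≤ B / r ^ 3 := by
  have hγ := halfMargin_pos hq0 hq1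
  have hm := two_halfMargin_le q
  have m1 := momentConst_pos 1
  have m3 := momentConst_pos 3
  set ε := halfMargin q with hε
  set c₁ := fixedConst p ε K with hc₁
  have hc₁0 : 0 ≤ c₁ := fixedConst_nonneg hp0 hp1 hγ hK
  set cR := 4 + 9 / ε ^ 2 * K ^ 2 with hcR
  set cM := 4 + 2 / ε ^ 2 with hcM
  set lR := (12 / ε ^ 2 + 9 / ε ^ 4) * K ^ 2 with hlR
  set lM := 4 / ε ^ 4 with hlM
  -- `BR` and `BM` bound the errors of the averaged conditional covariances, and `E` the covariances
  -- over `X` of the conditional means.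
  set BR := cR * momentConst 3 / ε ^ 6 + c₁ + lR * (momentConst 1 + 1) with hBR
  set BM := cM * momentConst 3 / ε ^ 6 + c₁ + lM * (momentConst 1 + 1) with hBM
  set E := 4 * (2 * momentConst 3 / ε ^ 6 + c₁) with hE
  have hBR0 : 0 ≤ BR := by positivity
  have hBM0 : 0 ≤ BM := by positivity
  refine ⟨BR + BM + E, ?_⟩
  intro ι _ _ C D N r h hr hN hc hC hD
  have hr0 : 0 < r := by linarith
  have hN0 : 0 < N := by rw [hN]; positivity
  have hN1 : 1 ≤ N := by rw [hN]; nlinarith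
  have hwX := isWeight_const (ι := ι) hq0.le hq1.le
  have sK : K / r ≤ K := div_le_self hK hr
  have s0 : 0 ≤ K / r := by positivity
  have fx := fun (x : ι → Bool) (hx : |sizeDev q x| ≤ halfMargin q) =>
    fixed_expansions hp0 hp1 hq₀ hq₁ h hγ hr hN
      (arms_of_sizeDev hN0 hc hq0 hq1 hx).2.2.1 (arms_of_sizeDev hN0 hc hq0 hq1 hx).2.2.2.1
      (arms_of_sizeDev hN0 hc hq0 hq1 hx).2.2.2.2 hC hD
  have dev : ∀ x : ι → Bool, armSize x true / N - q = sizeDev q x := fun x => by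
    rw [armSize_true_div hN0 hc q x]; ring
  have crudeR : ∀ x : ι → Bool, |armCov x p (VStructure.tableY p q₀ q₁ C D) (rEst x)
      (fun z y => mEst x z y - rEst x z y)| ≤ 4 := fun x => by
    have := abs_armCov_le h x hp0.le hp1.le (abs_rEst_le x) (abs_mEst_sub_rEst_le x) zero_le_one
    linarith
  have crudeM : ∀ x : ι → Bool, |armCov x p (VStructure.tableY p q₀ q₁ C D) (mEst x)
      (fun z y => mEst x z y - rEst x z y)| ≤ 4 := fun x => by
    have := abs_armCov_le h x hp0.le hp1.le (abs_mEst_le x) (abs_mEst_sub_rEst_le x) zero_le_one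
    linarith
  have hqε : ε ≤ q := by linarith [hm.1]
  have hqε' : ε ≤ 1 - q := by linarith [hm.2]
  have R1 := abs_wE_sub_le_of_sizeDev (ι := ι) (c₁ := c₁) (c₂ := cR) (c₃ := lR)
    (L := -VStructure.leadR p C D q) hr hN hc hq0 hq1 hc₁0 (by positivity) (by positivity)
    (F := fun x => N * armCov x p (VStructure.tableY p q₀ q₁ C D) (rEst x)
      (fun z y => mEst x z y - rEst x z y)) (fun x hx => by
      have a := (fx x hx).1
      have b := leadR_lipschitz hp0.le hp1.le hγ hqε hqε'
        (arms_of_sizeDev hN0 hc hq0 hq1 hx).1 (arms_of_sizeDev hN0 hc hq0 hq1 hx).2.1 hC hD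
      rw [dev] at b
      have e : lR / r ^ 2 * |sizeDev q x| =
        (12 / ε ^ 2 + 9 / ε ^ 4) * (K / r) ^ 2 * |sizeDev q x| := by rw [hlR]; field_simp
      rw [e]
      rw [abs_sub_comm] at b
      refine le_trans (le_of_eq ?_) ((abs_add_le _ _).trans (add_le_add a b))
      congr 1; ring) (fun x => by
      have a := abs_leadR_le hp0.le hp1.le hγ hqε hqε' hC hD
      have b : 9 / ε ^ 2 * (K / r) ^ 2 ≤ 9 / ε ^ 2 * K ^ 2 * r ^ 2 := by
        rw [mul_assoc]
        gcongr
        calc (K / r) ^ 2 ≤ K ^ 2 := by gcongr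
          _ ≤ K ^ 2 * r ^ 2 := le_mul_of_one_le_right (sq_nonneg K) (by rw [← hN]; exact hN1)
      rw [sub_neg_eq_add]
      refine (abs_add_le _ _).trans ?_
      rw [abs_mul, abs_of_pos hN0, hN, hcR]
      have := mul_le_mul_of_nonneg_left (crudeR x) (sq_nonneg r)
      linarith)
  have M1 := abs_wE_sub_le_of_sizeDev (ι := ι) (c₁ := c₁) (c₂ := cM) (c₃ := lM)
    (L := VStructure.leadM q₀ q₁ N q) hr hN hc hq0 hq1 hc₁0 (by positivity) (by positivity)
    (F := fun x => N * armCov x p (VStructure.tableY p q₀ q₁ C D) (mEst x)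
      (fun z y => mEst x z y - rEst x z y)) (fun x hx => by
      have a := (fx x hx).2.1
      have b := leadM_lipschitz hq₀ hq₁ hN0 hγ hqε hqε'
        (arms_of_sizeDev hN0 hc hq0 hq1 hx).1 (arms_of_sizeDev hN0 hc hq0 hq1 hx).2.1
      rw [dev] at b
      rw [← hN]
      refine le_trans (le_of_eq ?_) ((abs_add_le _ _).trans (add_le_add a b))
      congr 1; ring) (fun x => by
      have a := abs_leadM_le hq₀ hq₁ hN0 hγ hqε hqε'
      have b : 2 / ε ^ 2 / N ≤ 2 / ε ^ 2 * r ^ 2 := by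
        rw [← hN]
        exact (div_le_self (by positivity) hN1).trans (le_mul_of_one_le_right (by positivity) hN1)
      refine (abs_sub _ _).trans ?_
      rw [abs_mul, abs_of_pos hN0, hN, hcM]
      rw [hN] at a b
      have := mul_le_mul_of_nonneg_left (crudeM x) (sq_nonneg r)
      linarith)
  -- A conditional mean given `X` lies within `c₁ / r⁵` of the constant `q₁ - q₀` when the arms are
  -- balanced, so its covariance with a bounded function is negligible.
  have meanBound : ∀ (f : (ι → Bool) → ℝ), (∀ x, |f x| ≤ 1) →
      (∀ x, |sizeDev q x| ≤ halfMargin q → |f x - (q₁ - q₀)| ≤ c₁ / r ^ 5) →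
      |N * wCov (bernWeight fun _ : ι => q) f (fun x => armExp x p
        (VStructure.tableY p q₀ q₁ C D) (fun z y => mEst x z y - rEst x z y))| ≤ E / r ^ 3 := by
    intro f hf hf'
    have hφ : ∀ x, |f x - (q₁ - q₀)| ≤ 2 / ε ^ 6 * sizeDev q x ^ (2 * 3) + c₁ / r ^ 5 := by
      intro x
      have hd6 : 0 ≤ sizeDev q x ^ (2 * 3) := Even.pow_nonneg ⟨3, rfl⟩ _
      by_cases hx : |sizeDev q x| ≤ halfMargin q
      · have := hf' x hx
        have : 0 ≤ 2 / ε ^ 6 * sizeDev q x ^ (2 * 3) := by positivity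
        linarith
      · have h6 : ε ^ 6 ≤ sizeDev q x ^ (2 * 3) := by
          have := pow_le_pow_left₀ hγ.le (not_le.1 hx).le 6
          rwa [Even.pow_abs ⟨3, rfl⟩] at this
        have a : 2 ≤ 2 / ε ^ 6 * sizeDev q x ^ (2 * 3) := by
          rw [div_mul_eq_mul_div, le_div_iff₀ (by positivity)]
          gcongr
        have b : |f x - (q₁ - q₀)| ≤ 2 := by
          have := abs_le.1 (hf x)
          rw [abs_le]; constructor <;> linarith [this.1, this.2, hq₀.1, hq₀.2, hq₁.1, hq₁.2]
        have : 0 ≤ c₁ / r ^ 5 := by positivity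
        linarith
    have k := abs_wCov_le_mul hwX (d := 2) (g := fun x => armExp x p
        (VStructure.tableY p q₀ q₁ C D) (fun z y => mEst x z y - rEst x z y) - 0) hφ (fun x => by
      rw [sub_zero]
      exact abs_armExp_le h x hp0.le hp1.le (abs_mEst_sub_rEst_le x))
    rw [wCov_sub_const hwX, wE_add, wE_const hwX, wE_mul_left] at k
    have m3' := wE_sizeDev_moment_le hN1 hc hq0.le hq1.le 3
    rw [abs_mul, abs_of_pos hN0]
    calc _ ≤ N * (2 * 2 * (2 / ε ^ 6 * (momentConst 3 / N ^ 3) + c₁ / r ^ 5)) := by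
          refine mul_le_mul_of_nonneg_left (k.trans ?_) hN0.le
          gcongr
      _ = 4 * (2 * momentConst 3 / ε ^ 6) / r ^ 4 + 4 * c₁ / r ^ 3 := by
        rw [hN]; field_simp; norm_num
      _ ≤ 4 * (2 * momentConst 3 / ε ^ 6) / r ^ 3 + 4 * c₁ / r ^ 3 := by
        gcongr
        norm_num
      _ = _ := by rw [hE]; ring
  have R2 := meanBound (fun x => armExp x p (VStructure.tableY p q₀ q₁ C D) (rEst x))
    (fun x => abs_armExp_le h x hp0.le hp1.le (abs_rEst_le x)) (fun x hx => by
      rw [armExp_rEst (fun a => zero_lt_one.trans_le ((arms_of_sizeDev hN0 hc hq0 hq1 hx).2.2.2.2 a))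
        hp0 hp1 h, sub_self, abs_zero]
      positivity)
  have M2 := meanBound (fun x => armExp x p (VStructure.tableY p q₀ q₁ C D) (mEst x))
    (fun x => abs_armExp_le h x hp0.le hp1.le (abs_mEst_le x)) (fun x hx => (fx x hx).2.2)
  rw [wE_mul_left] at R1 M1
  have r3 : 0 < r ^ 3 := by positivity
  have eB : (BR + BM + E) / r ^ 3 = BR / r ^ 3 + BM / r ^ 3 + E / r ^ 3 := by ring
  have hBR' : 0 ≤ BR / r ^ 3 := by positivity
  have hBM' : 0 ≤ BM / r ^ 3 := by positivity
  rw [eB]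
  constructor
  · rw [randCov_eq]
    rw [← hBR] at R1
    rw [abs_le] at R1 R2 ⊢
    constructor <;> linarith [R1.1, R1.2, R2.1, R2.2]
  · rw [randCov_eq]
    rw [← hBM] at M1
    rw [abs_le] at M1 M2 ⊢
    constructor <;> linarith [M1.1, M1.2, M2.1, M2.2]

end Random

/-! ### From measures on finite types to weights -/

section FiniteMeasures

variable {α : Type*} [Fintype α] [MeasurableSpace α] [MeasurableSingletonClass α]

theorem sum_smul_dirac_singleton (g : α → ℝ) (v : α) :
    (∑ u, ENNReal.ofReal (g u) • Measure.dirac u : Measure α) {v} = ENNReal.ofReal (g v) := by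
  classical
  rw [Measure.finsetSum_apply, Finset.sum_eq_single v]
  · simp
  · intro u _ hu
    simp [hu]
  · simp

theorem isProbabilityMeasure_sum_smul_dirac {g : α → ℝ} (hg : ∀ v, 0 ≤ g v) (hs : ∑ v, g v = 1) :
    IsProbabilityMeasure (∑ u, ENNReal.ofReal (g u) • Measure.dirac u : Measure α) where
  measure_univ := by
    rw [Measure.finsetSum_apply]
    simp [← ENNReal.ofReal_sum_of_nonneg (fun v _ => hg v), hs]

theorem integral_eq_wE {μ : Measure α} [IsFiniteMeasure μ] {w : α → ℝ} (hw : ∀ v, μ.real {v} = w v)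
    (f : α → ℝ) : ∫ v, f v ∂μ = wE w f := by
  rw [integral_fintype Integrable.of_finite, wE]
  simp [hw]

theorem covariance_eq_wCov {μ : Measure α} [IsProbabilityMeasure μ] {w : α → ℝ}
    (hw : ∀ v, μ.real {v} = w v) (f g : α → ℝ) : covariance f g μ = wCov w f g := by
  rw [covariance_eq_sub MemLp.of_discrete MemLp.of_discrete, integral_eq_wE hw, integral_eq_wE hw,
    integral_eq_wE hw]
  rfl

theorem variance_eq_wCov {μ : Measure α} [IsProbabilityMeasure μ] {w : α → ℝ}
    (hw : ∀ v, μ.real {v} = w v) (f : α → ℝ) : variance f μ = wCov w f f := by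
  rw [← covariance_self (measurable_of_finite f).aemeasurable, covariance_eq_wCov hw]

theorem pi_real_singleton {ι : Type*} [Fintype ι] {μ : ι → Measure α}
    [∀ i, IsProbabilityMeasure (μ i)] {w : ι → α → ℝ} (hw : ∀ i v, (μ i).real {v} = w i v)
    (ω : ι → α) : (Measure.pi μ).real {ω} = ∏ i, w i (ω i) := by
  simp only [Measure.real, Measure.pi_singleton, ENNReal.toReal_prod]
  exact Finset.prod_congr rfl fun i _ => hw i _

end FiniteMeasures

/-! ### The two sampling laws as weights -/

section Laws

variable {pZ : ℝ} {pY : Bool → Bool → ℝ}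

theorem bern_nonneg {p : ℝ} (h0 : 0 ≤ p) (h1 : p ≤ 1) (b : Bool) : 0 ≤ VStructure.bern p b := by
  unfold VStructure.bern; split_ifs <;> linarith

theorem armLaw_isProbability (h0 : 0 ≤ pZ) (h1 : pZ ≤ 1) (h : VStructure.ValidTable pY) (a : Bool) :
    IsProbabilityMeasure (VStructure.armLaw pZ pY a) := by
  refine isProbabilityMeasure_sum_smul_dirac (fun v => mul_nonneg (bern_nonneg h0 h1 _)
    (bern_nonneg (h _ _).1 (h _ _).2 _)) ?_
  simp [Fintype.sum_prod_type, VStructure.bern]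
  ring

theorem armLaw_real (h0 : 0 ≤ pZ) (h1 : pZ ≤ 1) (h : VStructure.ValidTable pY) (a : Bool)
    (v : Bool × Bool) : (VStructure.armLaw pZ pY a).real {v} =
      VStructure.bern pZ v.1 * VStructure.bern (pY a v.1) v.2 := by
  rw [Measure.real, VStructure.armLaw, sum_smul_dirac_singleton
    (fun v : Bool × Bool => VStructure.bern pZ v.1 * VStructure.bern (pY a v.1) v.2),
    ENNReal.toReal_ofReal]
  exact mul_nonneg (bern_nonneg h0 h1 _) (bern_nonneg (h _ _).1 (h _ _).2 _)

theorem unitLaw_isProbability {pX : ℝ} (hX0 : 0 ≤ pX) (hX1 : pX ≤ 1) (h0 : 0 ≤ pZ) (h1 : pZ ≤ 1)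
    (h : VStructure.ValidTable pY) : IsProbabilityMeasure (VStructure.unitLaw pX pZ pY) := by
  refine isProbabilityMeasure_sum_smul_dirac (fun v => mul_nonneg (mul_nonneg
    (bern_nonneg hX0 hX1 _) (bern_nonneg h0 h1 _)) (bern_nonneg (h _ _).1 (h _ _).2 _)) ?_
  simp [Fintype.sum_prod_type, VStructure.bern]
  ring

theorem unitLaw_real {pX : ℝ} (hX0 : 0 ≤ pX) (hX1 : pX ≤ 1) (h0 : 0 ≤ pZ) (h1 : pZ ≤ 1)
    (h : VStructure.ValidTable pY) (v : Bool × Bool × Bool) :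
    (VStructure.unitLaw pX pZ pY).real {v} =
      VStructure.bern pX v.1 * VStructure.bern pZ v.2.1 *
        VStructure.bern (pY v.1 v.2.1) v.2.2 := by
  rw [Measure.real, VStructure.unitLaw, sum_smul_dirac_singleton
    (fun v : Bool × Bool × Bool => VStructure.bern pX v.1 * VStructure.bern pZ v.2.1 *
        VStructure.bern (pY v.1 v.2.1) v.2.2), ENNReal.toReal_ofReal]
  exact mul_nonneg (mul_nonneg (bern_nonneg hX0 hX1 _) (bern_nonneg h0 h1 _))
    (bern_nonneg (h _ _).1 (h _ _).2 _)

/-- The weights of a sample with fixed `X = x`. -/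
def armWeight {ι : Type*} [Fintype ι] (x : ι → Bool) (pZ : ℝ) (pY : Bool → Bool → ℝ)
    (ω : ι → Bool × Bool) : ℝ :=
  ∏ i, VStructure.bern pZ (ω i).1 * VStructure.bern (pY (x i) (ω i).1) (ω i).2

theorem wE_armWeight {ι : Type*} [Fintype ι] [DecidableEq ι] (x : ι → Bool)
    (f : (ι → Bool) → (ι → Bool) → ℝ) :
    wE (armWeight x pZ pY) (fun ω => f (fun i => (ω i).1) (fun i => (ω i).2)) =
      armExp x pZ pY f := by
  rw [wE, ← (Equiv.arrowProdEquivProdArrow ι (fun _ => Bool) (fun _ => Bool)).symm.sum_comp,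
    Fintype.sum_prod_type]
  simp only [armExp, wE, Finset.mul_sum]
  refine Finset.sum_congr rfl fun z _ => Finset.sum_congr rfl fun y _ => ?_
  simp [armWeight, outcomeWeight, bernWeight, Finset.prod_mul_distrib, Equiv.arrowProdEquivProdArrow]
  ring

/-- The assignment of `n₀` units to the arm `X = 0` and of `n₁` units to the arm `X = 1`. -/
def blockArm (n₀ n₁ : ℕ) : Fin n₀ ⊕ Fin n₁ → Bool := Sum.elim (fun _ => false) fun _ => true

/-- The weights of a block-randomised sample. -/
def fixedWeight (pZ : ℝ) (pY : Bool → Bool → ℝ) (n₀ n₁ : ℕ)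
    (ω : (Fin n₀ → Bool × Bool) × (Fin n₁ → Bool × Bool)) : ℝ :=
  (∏ i, VStructure.bern pZ (ω.1 i).1 * VStructure.bern (pY false (ω.1 i).1) (ω.1 i).2) *
    ∏ i, VStructure.bern pZ (ω.2 i).1 * VStructure.bern (pY true (ω.2 i).1) (ω.2 i).2

theorem fixedLaw_isProbability (h0 : 0 ≤ pZ) (h1 : pZ ≤ 1) (h : VStructure.ValidTable pY)
    (n₀ n₁ : ℕ) : IsProbabilityMeasure (VStructure.fixedLaw pZ pY n₀ n₁) := by
  have := armLaw_isProbability h0 h1 h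
  unfold VStructure.fixedLaw
  infer_instance

theorem fixedLaw_real (h0 : 0 ≤ pZ) (h1 : pZ ≤ 1) (h : VStructure.ValidTable pY) (n₀ n₁ : ℕ)
    (ω : (Fin n₀ → Bool × Bool) × (Fin n₁ → Bool × Bool)) :
    (VStructure.fixedLaw pZ pY n₀ n₁).real {ω} = fixedWeight pZ pY n₀ n₁ ω := by
  have := armLaw_isProbability h0 h1 h
  obtain ⟨ω₀, ω₁⟩ := ω
  rw [VStructure.fixedLaw, ← Set.singleton_prod_singleton, measureReal_prod_prod,
    pi_real_singleton (fun _ => armLaw_real h0 h1 h false),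
    pi_real_singleton (fun _ => armLaw_real h0 h1 h true), fixedWeight]

/-- The estimators see a sample only through its counts, so a block-randomised sample is one indexed
by `Fin n₀ ⊕ Fin n₁` with the deterministic assignment `blockArm`. -/
theorem wE_fixedWeight (n₀ n₁ : ℕ) (F : (Bool → Bool → Bool → ℕ) → ℝ) :
    wE (fixedWeight pZ pY n₀ n₁) (fun ω => F (VStructure.fixedCount ω)) =
      armExp (blockArm n₀ n₁) pZ pY (fun z y => F (tripleCount (blockArm n₀ n₁) z y)) := by
  rw [← wE_armWeight, wE, wE,
    ← (Equiv.sumArrowEquivProdArrow (Fin n₀) (Fin n₁) (Bool × Bool)).sum_comp]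
  refine Finset.sum_congr rfl fun ω _ => ?_
  congr 1
  · simp [fixedWeight, armWeight, blockArm, Fintype.prod_sum_type, Equiv.sumArrowEquivProdArrow]
  · congr 1
    funext a b c
    cases a <;>
      simp only [VStructure.fixedCount, tripleCount, Finset.card_filter, Fintype.sum_sum_type] <;>
      simp [-Finset.sum_boole, blockArm, Equiv.sumArrowEquivProdArrow, Prod.ext_iff]

theorem wCov_fixedWeight (n₀ n₁ : ℕ) (F G : (Bool → Bool → Bool → ℕ) → ℝ) :
    wCov (fixedWeight pZ pY n₀ n₁) (fun ω => F (VStructure.fixedCount ω))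
        (fun ω => G (VStructure.fixedCount ω)) =
      armCov (blockArm n₀ n₁) pZ pY (fun z y => F (tripleCount (blockArm n₀ n₁) z y))
        (fun z y => G (tripleCount (blockArm n₀ n₁) z y)) := by
  rw [wCov, wE_fixedWeight, wE_fixedWeight, wE_fixedWeight n₀ n₁ (fun n => F n * G n), armCov]

/-- The weights of a sample with random `X`. -/
def randomWeight (pX pZ : ℝ) (pY : Bool → Bool → ℝ) (N : ℕ) (ω : Fin N → Bool × Bool × Bool) : ℝ :=
  ∏ i, VStructure.bern pX (ω i).1 * VStructure.bern pZ (ω i).2.1 *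
    VStructure.bern (pY (ω i).1 (ω i).2.1) (ω i).2.2

theorem randomLaw_isProbability {pX : ℝ} (hX0 : 0 ≤ pX) (hX1 : pX ≤ 1) (h0 : 0 ≤ pZ) (h1 : pZ ≤ 1)
    (h : VStructure.ValidTable pY) (N : ℕ) :
    IsProbabilityMeasure (VStructure.randomLaw pX pZ pY N) := by
  have := unitLaw_isProbability hX0 hX1 h0 h1 h
  unfold VStructure.randomLaw
  infer_instance

theorem randomLaw_real {pX : ℝ} (hX0 : 0 ≤ pX) (hX1 : pX ≤ 1) (h0 : 0 ≤ pZ) (h1 : pZ ≤ 1)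
    (h : VStructure.ValidTable pY) (N : ℕ) (ω : Fin N → Bool × Bool × Bool) :
    (VStructure.randomLaw pX pZ pY N).real {ω} = randomWeight pX pZ pY N ω := by
  have := unitLaw_isProbability hX0 hX1 h0 h1 h
  rw [VStructure.randomLaw, pi_real_singleton (fun _ => unitLaw_real hX0 hX1 h0 h1 h), randomWeight]

/-- Separating the `X` coordinates from the rest exhibits the random sample as a mixture of samples
with fixed `X`. -/
theorem wE_randomWeight (pX : ℝ) (N : ℕ) (F : (Bool → Bool → Bool → ℕ) → ℝ) :
    wE (randomWeight pX pZ pY N) (fun ω => F (VStructure.randomCount ω)) =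
      randExp (ι := Fin N) pX pZ pY (fun x z y => F (tripleCount x z y)) := by
  rw [wE, ← (Equiv.arrowProdEquivProdArrow (Fin N) (fun _ => Bool)
    (fun _ => Bool × Bool)).symm.sum_comp, Fintype.sum_prod_type, randExp, wE]
  refine Finset.sum_congr rfl fun x _ => ?_
  rw [← wE_armWeight, wE, Finset.mul_sum]
  refine Finset.sum_congr rfl fun ω _ => ?_
  rw [← mul_assoc]
  congr 1
  · simp [randomWeight, armWeight, bernWeight, Finset.prod_mul_distrib,
      Equiv.arrowProdEquivProdArrow]
    ring
  · congr 1
    funext a b c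
    simp [VStructure.randomCount, tripleCount, Equiv.arrowProdEquivProdArrow, Prod.ext_iff]

theorem wCov_randomWeight (pX : ℝ) (N : ℕ) (F G : (Bool → Bool → Bool → ℕ) → ℝ) :
    wCov (randomWeight pX pZ pY N) (fun ω => F (VStructure.randomCount ω))
        (fun ω => G (VStructure.randomCount ω)) =
      randCov (ι := Fin N) pX pZ pY (fun x z y => F (tripleCount x z y))
        (fun x z y => G (tripleCount x z y)) := by
  rw [wCov, wE_randomWeight, wE_randomWeight, wE_randomWeight pX N (fun n => F n * G n), randCov]

end Laws

/-! ### Linear combinations and assembly of the three expansions -/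

theorem wCov_combination {Ω : Type*} [Fintype Ω] {w : Ω → ℝ} (f g : Ω → ℝ) (s t : ℝ) :
    wCov w (fun b => s * f b + t * g b) (fun b => s * f b + t * g b) =
      s ^ 2 * wCov w f f + 2 * s * t * wCov w f g + t ^ 2 * wCov w g g := by
  have h : (fun b => (s * f b + t * g b) * (s * f b + t * g b)) = fun b =>
      s ^ 2 * (f b * f b) + (2 * s * t * (f b * g b) + t ^ 2 * (g b * g b)) := by
    funext b; ring
  simp only [wCov, h, wE_add, wE_mul_left]
  ring

/-- With `a = vR - c` and `b = vM - c` the left side equals `c + ab/(a + b)`, and `ab/(a + b)` is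
smaller than both `a` and `b`. -/
theorem combination_lt_min {vR vM c : ℝ} (hR : c < vR) (hM : c < vM) :
    VStructure.optWeight vR vM c ^ 2 * vR +
      2 * VStructure.optWeight vR vM c * (1 - VStructure.optWeight vR vM c) * c +
      (1 - VStructure.optWeight vR vM c) ^ 2 * vM < min vR vM := by
  have hu : 0 < vR - c := by linarith
  have hw : 0 < vM - c := by linarith
  have hs : 0 < (vR - c) + (vM - c) := by linarith
  have e : VStructure.optWeight vR vM c ^ 2 * vR +
      2 * VStructure.optWeight vR vM c * (1 - VStructure.optWeight vR vM c) * c +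
      (1 - VStructure.optWeight vR vM c) ^ 2 * vM =
      c + (vR - c) * (vM - c) / ((vR - c) + (vM - c)) := by
    unfold VStructure.optWeight
    field_simp; ring
  rw [e, lt_min_iff]
  constructor
  · have : (vR - c) * (vM - c) / ((vR - c) + (vM - c)) < vR - c := by
      rw [div_lt_iff₀ hs]; nlinarith
    linarith
  · have : (vR - c) * (vM - c) / ((vR - c) + (vM - c)) < vM - c := by
      rw [div_lt_iff₀ hs]; nlinarith
    linarith

theorem rpow_neg_three_half {N : ℝ} (hN : 0 < N) : N ^ (-(3 / 2) : ℝ) = 1 / √N ^ 3 := by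
  rw [Real.rpow_neg hN.le, Real.sqrt_eq_rpow, ← Real.rpow_natCast, ← Real.rpow_mul hN.le, one_div]
  norm_num

/-- The expansion of `vM - vR` is the sum of the two given ones, which explains the factor 2. -/
theorem expansions_of_bounds {B pZ q₀ q₁ C D p vR vM c : ℝ} {N : ℕ} (hN : 1 ≤ N)
    (h1 : |(N : ℝ) * (c - vR) + VStructure.leadR pZ C D p| ≤ B / √(N : ℝ) ^ 3)
    (h2 : |(N : ℝ) * (vM - c) - VStructure.leadM q₀ q₁ N p| ≤ B / √(N : ℝ) ^ 3) :
    VStructure.Expansions (2 * B) pZ q₀ q₁ C D p N vR vM c := by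
  have hN0 : (0 : ℝ) < N := by exact_mod_cast hN
  have e : 2 * B * (1 / √(N : ℝ) ^ 3) = B / √(N : ℝ) ^ 3 + B / √(N : ℝ) ^ 3 := by ring
  have h0 := (abs_nonneg _).trans h1
  unfold VStructure.Expansions
  rw [rpow_neg_three_half hN0, e]
  rw [abs_le] at h1 h2
  refine ⟨?_, ?_, ?_⟩ <;> rw [abs_le] <;> constructor <;> linarith [h1.1, h1.2, h2.1, h2.2]

theorem armSize_blockArm_true (n₀ n₁ : ℕ) : armSize (blockArm n₀ n₁) true = n₁ := by
  simp [armSize, blockArm, Fintype.sum_sum_type]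

theorem armSize_blockArm_false (n₀ n₁ : ℕ) : armSize (blockArm n₀ n₁) false = n₀ := by
  simp [armSize, blockArm, Fintype.sum_sum_type]

/-! ### Variance differences as covariances with `M - R` -/

section Moments

variable {pZ : ℝ} {pY : Bool → Bool → ℝ}

theorem fixedCov_sub_fixedVarR (h0 : 0 ≤ pZ) (h1 : pZ ≤ 1) (h : VStructure.ValidTable pY)
    (n₀ n₁ : ℕ) : VStructure.fixedCov pZ pY n₀ n₁ - VStructure.fixedVarR pZ pY n₀ n₁ =
      armCov (blockArm n₀ n₁) pZ pY (rEst (blockArm n₀ n₁))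
        (fun z y => mEst (blockArm n₀ n₁) z y - rEst (blockArm n₀ n₁) z y) := by
  have := fixedLaw_isProbability h0 h1 h n₀ n₁
  rw [VStructure.fixedCov, VStructure.fixedVarR, covariance_eq_wCov (fixedLaw_real h0 h1 h n₀ n₁),
    variance_eq_wCov (fixedLaw_real h0 h1 h n₀ n₁), ← wCov_sub_right]
  exact wCov_fixedWeight n₀ n₁ VStructure.estR (fun n => VStructure.estM n - VStructure.estR n)

theorem fixedVarM_sub_fixedCov (h0 : 0 ≤ pZ) (h1 : pZ ≤ 1) (h : VStructure.ValidTable pY)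
    (n₀ n₁ : ℕ) : VStructure.fixedVarM pZ pY n₀ n₁ - VStructure.fixedCov pZ pY n₀ n₁ =
      armCov (blockArm n₀ n₁) pZ pY (mEst (blockArm n₀ n₁))
        (fun z y => mEst (blockArm n₀ n₁) z y - rEst (blockArm n₀ n₁) z y) := by
  have := fixedLaw_isProbability h0 h1 h n₀ n₁
  rw [VStructure.fixedCov, VStructure.fixedVarM, covariance_eq_wCov (fixedLaw_real h0 h1 h n₀ n₁),
    variance_eq_wCov (fixedLaw_real h0 h1 h n₀ n₁), wCov_comm (fun ω => VStructure.estR _),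
    ← wCov_sub_right]
  exact wCov_fixedWeight n₀ n₁ VStructure.estM (fun n => VStructure.estM n - VStructure.estR n)

theorem fixedVarP_eq (h0 : 0 ≤ pZ) (h1 : pZ ≤ 1) (h : VStructure.ValidTable pY)
    (n₀ n₁ : ℕ) (α : ℝ) : VStructure.fixedVarP pZ pY n₀ n₁ α =
      α ^ 2 * VStructure.fixedVarR pZ pY n₀ n₁ +
        2 * α * (1 - α) * VStructure.fixedCov pZ pY n₀ n₁ +
        (1 - α) ^ 2 * VStructure.fixedVarM pZ pY n₀ n₁ := by
  have := fixedLaw_isProbability h0 h1 h n₀ n₁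
  rw [VStructure.fixedVarP, VStructure.fixedCov, VStructure.fixedVarM, VStructure.fixedVarR,
    covariance_eq_wCov (fixedLaw_real h0 h1 h n₀ n₁),
    variance_eq_wCov (fixedLaw_real h0 h1 h n₀ n₁), variance_eq_wCov (fixedLaw_real h0 h1 h n₀ n₁),
    variance_eq_wCov (fixedLaw_real h0 h1 h n₀ n₁), wCov_combination]

theorem randomCov_sub_randomVarR {pX : ℝ} (hX0 : 0 ≤ pX) (hX1 : pX ≤ 1) (h0 : 0 ≤ pZ)
    (h1 : pZ ≤ 1) (h : VStructure.ValidTable pY) (N : ℕ) :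
    VStructure.randomCov pX pZ pY N - VStructure.randomVarR pX pZ pY N =
      randCov (ι := Fin N) pX pZ pY rEst (fun x z y => mEst x z y - rEst x z y) := by
  have := randomLaw_isProbability hX0 hX1 h0 h1 h N
  rw [VStructure.randomCov, VStructure.randomVarR,
    covariance_eq_wCov (randomLaw_real hX0 hX1 h0 h1 h N),
    variance_eq_wCov (randomLaw_real hX0 hX1 h0 h1 h N), ← wCov_sub_right]
  exact wCov_randomWeight pX N VStructure.estR (fun n => VStructure.estM n - VStructure.estR n)

theorem randomVarM_sub_randomCov {pX : ℝ} (hX0 : 0 ≤ pX) (hX1 : pX ≤ 1) (h0 : 0 ≤ pZ)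
    (h1 : pZ ≤ 1) (h : VStructure.ValidTable pY) (N : ℕ) :
    VStructure.randomVarM pX pZ pY N - VStructure.randomCov pX pZ pY N =
      randCov (ι := Fin N) pX pZ pY mEst (fun x z y => mEst x z y - rEst x z y) := by
  have := randomLaw_isProbability hX0 hX1 h0 h1 h N
  rw [VStructure.randomCov, VStructure.randomVarM,
    covariance_eq_wCov (randomLaw_real hX0 hX1 h0 h1 h N),
    variance_eq_wCov (randomLaw_real hX0 hX1 h0 h1 h N),
    wCov_comm (fun ω => VStructure.estR _), ← wCov_sub_right]
  exact wCov_randomWeight pX N VStructure.estM (fun n => VStructure.estM n - VStructure.estR n)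

end Moments

/-! ### Lower bounds on the leading terms and the main theorem -/

theorem fixedLaw_expansions {pZ q₀ q₁ ε K ξ C D : ℝ} (hZ₀ : 0 < pZ) (hZ₁ : pZ < 1)
    (hq₀ : 0 ≤ q₀ ∧ q₀ ≤ 1) (hq₁ : 0 ≤ q₁ ∧ q₁ ≤ 1) (hε : 0 < ε) {N n₀ n₁ : ℕ} (hN : 1 ≤ N)
    (hn : n₀ + n₁ = N) (hξ : ξ = (n₁ : ℝ) / N) (h1 : ε ≤ ξ) (h2 : ξ ≤ 1 - ε)
    (hC : |C| ≤ K / √(N : ℝ)) (hD : |D| ≤ K / √(N : ℝ))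
    (h : VStructure.ValidTable (VStructure.tableY pZ q₀ q₁ C D)) :
    VStructure.Expansions (2 * fixedConst pZ ε K) pZ q₀ q₁ C D ξ N
        (VStructure.fixedVarR pZ (VStructure.tableY pZ q₀ q₁ C D) n₀ n₁)
        (VStructure.fixedVarM pZ (VStructure.tableY pZ q₀ q₁ C D) n₀ n₁)
        (VStructure.fixedCov pZ (VStructure.tableY pZ q₀ q₁ C D) n₀ n₁) := by
  have hN0 : (0 : ℝ) < N := by exact_mod_cast hN
  have hr : 1 ≤ √(N : ℝ) := Real.one_le_sqrt.2 (by exact_mod_cast hN)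
  have hs : (n₁ : ℝ) + n₀ = N := by rw [← hn]; push_cast; ring
  have ha : ∀ a, ε * N ≤ armSize (blockArm n₀ n₁) a := by
    rw [hξ, le_div_iff₀ hN0] at h1
    rw [hξ, div_le_iff₀ hN0] at h2
    intro a
    cases a
    · rw [armSize_blockArm_false]; linarith
    · rw [armSize_blockArm_true]; exact h1
  have key := fixed_expansions (x := blockArm n₀ n₁) (K := K) hZ₀ hZ₁ hq₀ hq₁ h hε hr
    (Real.sq_sqrt hN0.le).symm (by rw [armSize_blockArm_true, armSize_blockArm_false, hs]) ha
    (fun a => one_le_armSize ((mul_pos hε hN0).trans_le (ha a))) hC hD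
  rw [armSize_blockArm_true, ← hξ] at key
  refine expansions_of_bounds hN ?_ ?_
  · rw [fixedCov_sub_fixedVarR hZ₀.le hZ₁.le h]; exact key.1
  · rw [fixedVarM_sub_fixedCov hZ₀.le hZ₁.le h]; exact key.2.1

theorem le_leadR {p C D ξ κ r : ℝ} (hp0 : 0 < p) (hp1 : p < 1) (hξ0 : 0 < ξ) (hξ1 : ξ < 1)
    (hκ : 0 ≤ κ / r) (h : κ / r ≤ |2 * C + (2 * ξ - 1) * D|) :
    p * (1 - p) * κ ^ 2 / r ^ 2 ≤ VStructure.leadR p C D ξ := by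
  have h1 : (κ / r) ^ 2 ≤ (2 * C + (2 * ξ - 1) * D) ^ 2 := by
    rw [← sq_abs (2 * C + (2 * ξ - 1) * D)]; gcongr
  have hp1' : 0 < 1 - p := by linarith
  have hξ1' : 0 < 1 - ξ := by linarith
  have h2 : p * (1 - p) ≤ p * (1 - p) / (ξ * (1 - ξ)) := by
    rw [le_div_iff₀ (by positivity)]
    exact mul_le_of_le_one_right (by positivity) (by nlinarith)
  calc p * (1 - p) * κ ^ 2 / r ^ 2 = p * (1 - p) * (κ / r) ^ 2 := by ring
    _ ≤ p * (1 - p) / (ξ * (1 - ξ)) * (2 * C + (2 * ξ - 1) * D) ^ 2 := by gcongr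
    _ = _ := rfl

/-- Uses only `u² ≤ 1` and `1 - u ≥ ε` for `u = ξ` and `u = 1 - ξ`; the numerator on the left is
positive once one `q` is nondegenerate. -/
theorem le_leadM {q₀ q₁ ξ ε r N : ℝ} (hq₀ : 0 ≤ q₀ ∧ q₀ ≤ 1) (hq₁ : 0 ≤ q₁ ∧ q₁ ≤ 1)
    (hε : 0 < ε) (hξ : ε ≤ ξ) (hξ' : ξ ≤ 1 - ε) (hr : 0 < r) (hN : N = r ^ 2) :
    (q₁ * (1 - q₁) + q₀ * (1 - q₀)) * ε / r ^ 2 ≤ VStructure.leadM q₀ q₁ N ξ := by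
  have key : ∀ v u : ℝ, 0 ≤ v → ε ≤ u → ε ≤ 1 - u → v * ε / r ^ 2 ≤ v * (1 - u) / (N * u ^ 2) := by
    intro v u hv h1 h2
    have hu : 0 < u := by linarith
    rw [hN]
    have : 0 ≤ v * (1 - u) := mul_nonneg hv (by linarith)
    have hu2 : u ^ 2 ≤ 1 := by nlinarith
    gcongr
    exact mul_le_of_le_one_right (by positivity) hu2
  have k1 := key (q₁ * (1 - q₁)) ξ (mul_nonneg hq₁.1 (by linarith [hq₁.2])) hξ (by linarith)
  have k0 := key (q₀ * (1 - q₀)) (1 - ξ) (mul_nonneg hq₀.1 (by linarith [hq₀.2])) (by linarith)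
    (by linarith)
  rw [sub_sub_cancel] at k0
  unfold VStructure.leadM
  rw [add_mul, add_div]
  linarith

theorem mainTheorem6 (pZ q₀ q₁ : ℝ) (hZ₀ : 0 < pZ) (hZ₁ : pZ < 1)
    (hq₀ : 0 ≤ q₀ ∧ q₀ ≤ 1) (hq₁ : 0 ≤ q₁ ∧ q₁ ≤ 1) :
    -- the expansions for block-randomised X, at ξ = n₁ / N
    (∀ ε : ℝ, 0 < ε → ∀ K : ℝ, 0 < K → ∃ B : ℝ, ∀ (N n₀ n₁ : ℕ) (ξ C D : ℝ),
      1 ≤ N → n₀ + n₁ = N → ξ = (n₁ : ℝ) / N → ε ≤ ξ → ξ ≤ 1 - ε →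
      |C| ≤ K / √(N : ℝ) → |D| ≤ K / √(N : ℝ) →
      VStructure.ValidTable (VStructure.tableY pZ q₀ q₁ C D) →
      VStructure.Expansions B pZ q₀ q₁ C D ξ N
        (VStructure.fixedVarR pZ (VStructure.tableY pZ q₀ q₁ C D) n₀ n₁)
        (VStructure.fixedVarM pZ (VStructure.tableY pZ q₀ q₁ C D) n₀ n₁)
        (VStructure.fixedCov pZ (VStructure.tableY pZ q₀ q₁ C D) n₀ n₁)) ∧
    -- the same expansions for random X, at p_X
    (∀ pX : ℝ, 0 < pX → pX < 1 → ∀ K : ℝ, 0 < K → ∃ B : ℝ, ∀ (N : ℕ) (C D : ℝ),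
      1 ≤ N → |C| ≤ K / √(N : ℝ) → |D| ≤ K / √(N : ℝ) →
      VStructure.ValidTable (VStructure.tableY pZ q₀ q₁ C D) →
      VStructure.Expansions B pZ q₀ q₁ C D pX N
        (VStructure.randomVarR pX pZ (VStructure.tableY pZ q₀ q₁ C D) N)
        (VStructure.randomVarM pX pZ (VStructure.tableY pZ q₀ q₁ C D) N)
        (VStructure.randomCov pX pZ (VStructure.tableY pZ q₀ q₁ C D) N)) ∧
    -- block-randomised X: outside the degenerate cases in which a leading coefficient vanishes,
    -- the covariance is below both variances and the best linear combination beats R and M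
    ((0 < q₀ ∧ q₀ < 1) ∨ (0 < q₁ ∧ q₁ < 1) →
      ∀ ε : ℝ, 0 < ε → ∀ K : ℝ, 0 < K → ∀ κ : ℝ, 0 < κ →
      ∃ N₀ : ℕ, ∀ (N n₀ n₁ : ℕ) (ξ C D : ℝ),
        N₀ ≤ N → 1 ≤ N → n₀ + n₁ = N → ξ = (n₁ : ℝ) / N → ε ≤ ξ → ξ ≤ 1 - ε →
        |C| ≤ K / √(N : ℝ) → |D| ≤ K / √(N : ℝ) →
        κ / √(N : ℝ) ≤ |2 * C + (2 * ξ - 1) * D| →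
        ∀ pY : Bool → Bool → ℝ, pY = VStructure.tableY pZ q₀ q₁ C D →
        VStructure.ValidTable pY →
        ∀ vR vM c : ℝ, vR = VStructure.fixedVarR pZ pY n₀ n₁ →
          vM = VStructure.fixedVarM pZ pY n₀ n₁ → c = VStructure.fixedCov pZ pY n₀ n₁ →
          c < min vR vM ∧
          VStructure.fixedVarP pZ pY n₀ n₁ (VStructure.optWeight vR vM c) < min vR vM) := by
  refine ⟨?_, ?_, ?_⟩
  · intro ε hε K _
    exact ⟨2 * fixedConst pZ ε K, fun N n₀ n₁ ξ C D hN hn hξ h1 h2 hC hD h =>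
      fixedLaw_expansions hZ₀ hZ₁ hq₀ hq₁ hε hN hn hξ h1 h2 hC hD h⟩
  · intro pX hX0 hX1 K hK
    obtain ⟨B, hB⟩ := random_expansions hZ₀ hZ₁ hX0 hX1 hq₀ hq₁ hK.le
    refine ⟨2 * B, fun N C D hN hC hD h => ?_⟩
    have hN0 : (0 : ℝ) < N := by exact_mod_cast hN
    have key := hB (ι := Fin N) h (Real.one_le_sqrt.2 (by exact_mod_cast hN))
      (Real.sq_sqrt hN0.le).symm (by simp) hC hD
    refine expansions_of_bounds hN ?_ ?_
    · rw [randomCov_sub_randomVarR hX0.le hX1.le hZ₀.le hZ₁.le h]; exact key.1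
    · rw [randomVarM_sub_randomCov hX0.le hX1.le hZ₀.le hZ₁.le h]; exact key.2
  · intro hq ε hε K hK κ hκ
    set B := 2 * fixedConst pZ ε K with hBdef
    have hB : 0 ≤ B := mul_nonneg zero_le_two (fixedConst_nonneg hZ₀ hZ₁ hε hK.le)
    set sR := pZ * (1 - pZ) * κ ^ 2 with hsR
    set sM := (q₁ * (1 - q₁) + q₀ * (1 - q₀)) * ε with hsM
    have hsR0 : 0 < sR := by
      have : 0 < 1 - pZ := by linarith
      positivity
    have hsM0 : 0 < sM := by
      have v1 : 0 ≤ q₁ * (1 - q₁) := mul_nonneg hq₁.1 (by linarith [hq₁.2])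
      have v0 : 0 ≤ q₀ * (1 - q₀) := mul_nonneg hq₀.1 (by linarith [hq₀.2])
      refine mul_pos ?_ hε
      rcases hq with hq | hq
      · have := mul_pos hq.1 (sub_pos.2 hq.2); linarith
      · have := mul_pos hq.1 (sub_pos.2 hq.2); linarith
    -- From here on `√N` exceeds both `B / sR` and `B / sM`, so the error `B N^{-3/2}` is below the
    -- lower bounds `sR / N` and `sM / N` of the leading terms.
    obtain ⟨N₀, hN₀⟩ := exists_nat_gt ((B / sR + B / sM) ^ 2)
    refine ⟨N₀, ?_⟩
    rintro N n₀ n₁ ξ C D hNN hN hn hξ h1 h2 hC hD hsep pY rfl h vR vM c hvR hvM hc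
    have hN0 : (0 : ℝ) < N := by exact_mod_cast hN
    have hr : 0 < √(N : ℝ) := Real.sqrt_pos.2 hN0
    have hrN : (N : ℝ) = √(N : ℝ) ^ 2 := (Real.sq_sqrt hN0.le).symm
    have hlarge : B / sR + B / sM < √(N : ℝ) := by
      apply Real.lt_sqrt_of_sq_lt
      exact hN₀.trans_le (by exact_mod_cast hNN)
    have hBR : 0 ≤ B / sR := by positivity
    have hBM : 0 ≤ B / sM := by positivity
    have small : ∀ s : ℝ, 0 < s → B / s < √(N : ℝ) → B * (1 / √(N : ℝ) ^ 3) < s / √(N : ℝ) ^ 2 := by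
      intro s hs hlt
      rw [div_lt_iff₀ hs] at hlt
      rw [mul_one_div, div_lt_div_iff₀ (by positivity) (by positivity)]
      calc B * √(N : ℝ) ^ 2 < √(N : ℝ) * s * √(N : ℝ) ^ 2 := by gcongr
        _ = _ := by ring
    have smR := small sR hsR0 (by linarith)
    have smM := small sM hsM0 (by linarith)
    have lR := le_leadR (C := C) (D := D) hZ₀ hZ₁ (by linarith : 0 < ξ) (by linarith : ξ < 1)
      (by positivity) hsep
    have lM := le_leadM hq₀ hq₁ hε h1 h2 hr hrN
    have ex := fixedLaw_expansions hZ₀ hZ₁ hq₀ hq₁ hε hN hn hξ h1 h2 hC hD h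
    rw [← hvR, ← hvM, ← hc] at ex
    obtain ⟨-, eR, eM⟩ := ex
    rw [← hBdef, rpow_neg_three_half hN0] at eR eM
    have cR : c < vR := by
      have : (c - vR) * N < 0 := by linarith [(abs_le.1 eR).2]
      have := neg_of_mul_neg_left this hN0.le
      linarith
    have cM : c < vM := by
      have : (c - vM) * N < 0 := by linarith [(abs_le.1 eM).2]
      have := neg_of_mul_neg_left this hN0.le
      linarith
    refine ⟨lt_min cR cM, ?_⟩
    rw [fixedVarP_eq hZ₀.le hZ₁.le h, ← hvR, ← hvM, ← hc]
    exact combination_lt_min cR cM
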